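/- **Theorem 3.1** ($L^2$-stability of the semi-discrete LDG scheme). Let $0<\alpha<1$, $T>0$, and let $\Omega\subset\mathbb R^2$ be an open rectangle with a tensor-product mesh of elements $\Omega_{ij}=(x_{i-1/2},x_{i+1/2})\times(y_{j-1/2},y_{j+1/2})$, $1\le i\le N_x$, $1\le j\le N_y$ (with $N_x,N_y\ge1$). Let $\kappa:\Omega\to\mathbb R$ be measurable and bounded (of any sign), and let $C_{\max}$ be any constant with $e^{-\kappa(\mathbf x)t}\le C_{\max}$ for all $(t,\mathbf x)\in[0,T]\times\Omega$. For $k\ge0$ let $V_h^k$ be the space of functions whose restriction to each $\Omega_{ij}$ is a polynomial of degree at most $k$ in each variable, let $(\cdot,\cdot)_{\Omega_{ij}}$ be the $L^2(\Omega_{ij})$ inner product, and let $\|\cdot\|$ be the norm of $L^2(\Omega)$. Put $${}_0^CD_t^{\alpha,\kappa(\mathbf x)}u(t,\mathbf x)=\frac{e^{-\kappa(\mathbf x)t}}{\Gamma(1-\alpha)}\int_0^t(t-\tau)^{-\alpha}\,\partial_\tau\big(e^{\kappa(\mathbf x)\tau}u(\tau,\mathbf x)\big)\,d\tau .$$ Let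 $\sigma_1,\sigma_2\in\mathbb R\setminus\{1/2\}$. With one-sided limits $v^-$ (from the left, resp. from below) and $v^+$ (from the right, resp. from above), the generalized alternating fluxes are $\widehat{u_h}=\sigma_1u_h^-+(1-\sigma_1)u_h^+$, $\widehat{\mathbf p_h}=(1-\sigma_1)\mathbf p_h^-+\sigma_1\mathbf p_h^+$ on the vertical edges and $\widehat{u_h}=\sigma_2u_h^-+(1-\sigma_2)u_h^+$, $\widehat{\mathbf p_h}=(1-\sigma_2)\mathbf p_h^-+\sigma_2\mathbf p_h^+$ on the horizontal edges, where opposite sides of $\Omega$ are identified (periodic boundary conditions). Let $u_0\in L^2(\Omega)$, $1\le r\le\infty$, and let $u_h\in W^{1,r}(0,T;V_h^k)$ (in particular $u_h\in H^1(0,T;V_h^k)$, for $r=2$) and $\mathbf p_h\in L^2(0,T;V_h^k\times V_h^k)$ solve the semi-discrete scheme: for almost every $t\in(0,T]$, all elements $\Omega_{ij}$ with outward unit normal $\mathbf n$, all $v\in V_h^k$ and all $\mathbf w\in V_h^k\times V_h^k$, $$\begin{aligned} &({}_0^CD_t^{\alpha,\kappa}u_h,v)_{\Omega_{ij}}+(\mathbf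 p_h,\nabla v)_{\Omega_{ij}}-\int_{\partial\Omega_{ij}}\widehat{\mathbf p_h}\cdot\mathbf n\,v\,ds=0,\\ &(\mathbf p_h,\mathbf w)_{\Omega_{ij}}+(u_h,\nabla\cdot\mathbf w)_{\Omega_{ij}}-\int_{\partial\Omega_{ij}}\widehat{u_h}\,\mathbf w\cdot\mathbf n\,ds=0,\\ &(u_h(0),v)_{\Omega_{ij}}=(u_0,v)_{\Omega_{ij}}, \end{aligned}$$ where $v$ and $\mathbf w$ on $\partial\Omega_{ij}$ are the limits from inside $\Omega_{ij}$. Then $$\int_0^T\|u_h(t)\|^2\,dt\le C\,\|u_h(0)\|^2,\qquad C=\sec^2\Big(\frac{\pi\alpha}2\Big)\frac{T\max\{C_{\max}^6,1\}}{C_\alpha\,\Gamma(2-\alpha)},$$ $$C_\alpha=\frac1{\alpha+1}\Big(\frac{\alpha\pi}{\alpha+1}\Big)^{\alpha}\min\{C_{\max}^{-(4+4\alpha)},1\}.$$ In particular $C$ does not depend on the mesh, on $k$ or on $\sigma_1,\sigma_2$ (unconditional stability). -/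

import Mathlib

open MeasureTheory Set

namespace LDG

/-! ### Fractional calculus in time -/

/-- The Caputo derivative of order `α ∈ (0,1)` with base point `0`. -/
noncomputable def caputo (α : ℝ) (f : ℝ → ℝ) (t : ℝ) : ℝ :=
  (1 / Real.Gamma (1 - α)) * ∫ τ in (0 : ℝ)..t, (t - τ) ^ (-α) * deriv f τ

/-- The Caputo fractional substantial derivative `e^{-κt} D^α (e^{κt} f)`; the real number `κ` is
the value of the potential at the space point under consideration. -/
noncomputable def caputoSubst (α κ : ℝ) (f : ℝ → ℝ) (t : ℝ) : ℝ :=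
  Real.exp (-κ * t) * caputo α (fun τ => Real.exp (κ * τ) * f τ) t

/-- The scalar Sobolev space `W^{1,r}(0,T)` (continuous representatives); `r = 2` is `H¹(0,T)`. -/
def MemW1 (r : ENNReal) (T : ℝ) (f : ℝ → ℝ) : Prop :=
  AbsolutelyContinuousOnInterval f 0 T ∧ MemLp (deriv f) r (volume.restrict (Ioc 0 T))

/-! ### Rectangular tensor product meshes -/

/-- A tessellation of a rectangle into `Nx * Ny` rectangles, given by its grid lines
`x_{1/2} < ⋯ < x_{Nx+1/2}` and `y_{1/2} < ⋯ < y_{Ny+1/2}`. -/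
structure RectMesh (Nx Ny : ℕ) where
  xs : Fin (Nx + 1) → ℝ
  ys : Fin (Ny + 1) → ℝ
  xs_strictMono : StrictMono xs
  ys_strictMono : StrictMono ys

namespace RectMesh

variable {Nx Ny : ℕ} (M : RectMesh Nx Ny)

/-- The rectangle `Ω`. -/
def domain : Set (ℝ × ℝ) :=
  Ioo (M.xs 0) (M.xs (Fin.last Nx)) ×ˢ Ioo (M.ys 0) (M.ys (Fin.last Ny))

/-- Left, right, bottom and top coordinates of the elements. -/
def xL (i : Fin Nx) : ℝ := M.xs i.castSucc

def xR (i : Fin Nx) : ℝ := M.xs i.succ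

def yB (j : Fin Ny) : ℝ := M.ys j.castSucc

def yT (j : Fin Ny) : ℝ := M.ys j.succ

/-- The element `Ω_{ij} = I_i × J_j`. -/
def cell (i : Fin Nx) (j : Fin Ny) : Set (ℝ × ℝ) :=
  Ioo (M.xL i) (M.xR i) ×ˢ Ioo (M.yB j) (M.yT j)

end RectMesh

/-! ### Piecewise polynomials -/

/-- `Q^k`: real polynomials in two variables of degree at most `k` in each variable. -/
abbrev QPoly (k : ℕ) : Type := MvPolynomial.restrictDegree (Fin 2) ℝ k

/-- The value of a polynomial at a point of the plane. -/
noncomputable def ev (q : MvPolynomial (Fin 2) ℝ) (x : ℝ × ℝ) : ℝ :=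
  MvPolynomial.eval ![x.1, x.2] q

/-- The two partial derivatives. -/
noncomputable def dx (q : MvPolynomial (Fin 2) ℝ) : MvPolynomial (Fin 2) ℝ :=
  MvPolynomial.pderiv 0 q

noncomputable def dy (q : MvPolynomial (Fin 2) ℝ) : MvPolynomial (Fin 2) ℝ :=
  MvPolynomial.pderiv 1 q

/-- The space `V_h^k` of piecewise polynomials: on each element, a polynomial in `Q^k`. The
one-sided limits of such a function at an element boundary are the boundary values of the
polynomials of the adjacent elements. -/
abbrev BrokenPoly (Nx Ny k : ℕ) : Type := Fin Nx → Fin Ny → QPoly k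

section

variable {Nx Ny k : ℕ} (M : RectMesh Nx Ny)

/-- The `L²` norm of a piecewise polynomial. -/
noncomputable def l2norm (v : BrokenPoly Nx Ny k) : ℝ :=
  Real.sqrt (∑ i, ∑ j, ∫ x in M.cell i j, ev (v i j) x ^ 2)

/-- The space `W^{1,r}(0,T; V_h^k)`; as `V_h^k` has finite dimension, this is a condition on the
coefficients. -/
def MemW1Broken (r : ENNReal) (T : ℝ) (u : ℝ → BrokenPoly Nx Ny k) : Prop :=
  ∀ i j m, MemW1 r T (fun t => MvPolynomial.coeff m (u t i j : MvPolynomial (Fin 2) ℝ))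

/-- The space `L²(0,T; V_h^k)`, again through the coefficients. -/
def MemL2Broken (T : ℝ) (u : ℝ → BrokenPoly Nx Ny k) : Prop :=
  ∀ i j m, MemLp (fun t => MvPolynomial.coeff m (u t i j : MvPolynomial (Fin 2) ℝ)) 2
    (volume.restrict (Ioc 0 T))

/-! ### Numerical fluxes

Indices are cyclic (`i + 1` in `Fin Nx` wraps around), which is the periodic boundary condition:
the exterior trace at the right end of the last column is the trace of the first column at its
left end, and likewise in the second direction. -/

/-- The weighted average `σ v⁻ + (1 - σ) v⁺` on the right edge of the element `(i, j)`, at height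
`y`. -/
noncomputable def avgX [NeZero Nx] (σ : ℝ) (v : BrokenPoly Nx Ny k) (i : Fin Nx) (j : Fin Ny)
    (y : ℝ) : ℝ :=
  σ * ev (v i j) (M.xR i, y) + (1 - σ) * ev (v (i + 1) j) (M.xL (i + 1), y)

/-- The weighted average `σ v⁻ + (1 - σ) v⁺` on the top edge of the element `(i, j)`, at abscissa
`x`. -/
noncomputable def avgY [NeZero Ny] (σ : ℝ) (v : BrokenPoly Nx Ny k) (i : Fin Nx) (j : Fin Ny)
    (x : ℝ) : ℝ :=
  σ * ev (v i j) (x, M.yT j) + (1 - σ) * ev (v i (j + 1)) (x, M.yB (j + 1))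

/-- The boundary term `∫_{∂Ω_{ij}} (a n₁ w₁ + b n₂ w₂) ds`, with `n` the outward unit normal,
where `a` is the weighted average with weight `σ₁` of `f` on the vertical edges, `b` is the
weighted average with weight `σ₂` of `g` on the horizontal edges, and `w₁`, `w₂` are taken from
inside the element. -/
noncomputable def edgeTerm [NeZero Nx] [NeZero Ny] (σ₁ σ₂ : ℝ) (f g : BrokenPoly Nx Ny k)
    (i : Fin Nx) (j : Fin Ny) (w₁ w₂ : QPoly k) : ℝ :=
  (∫ y in (M.yB j)..(M.yT j),
      (avgX M σ₁ f i j y * ev w₁ (M.xR i, y) - avgX M σ₁ f (i - 1) j y * ev w₁ (M.xL i, y)))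
  + ∫ x in (M.xL i)..(M.xR i),
      (avgY M σ₂ g i j x * ev w₂ (x, M.yT j) - avgY M σ₂ g i (j - 1) x * ev w₂ (x, M.yB j))

/-- `(u, (p, q))` solves the semi-discrete LDG scheme on `(0,T]` with potential `κ`, initial datum
`u₀` and generalized alternating fluxes: the weights are `σ₁, σ₂` in the flux of `u` and
`1 - σ₁, 1 - σ₂` in the flux of `(p, q)`. The solution is sought in
`W^{1,r}(0,T; V_h^k) × L²(0,T; V_h^k × V_h^k)`. -/
structure IsSemidiscreteSolution [NeZero Nx] [NeZero Ny] (α T σ₁ σ₂ : ℝ) (κ u₀ : ℝ × ℝ → ℝ)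
    (r : ENNReal) (u p q : ℝ → BrokenPoly Nx Ny k) : Prop where
  regularity_u : MemW1Broken r T u
  regularity_p : MemL2Broken T p
  regularity_q : MemL2Broken T q
  /-- `(D^{α,κ} u, v) + ((p,q), ∇v) - ⟨(p̂,q̂)·n, v⟩ = 0` on every element. -/
  evolution : ∀ᵐ t ∂(volume.restrict (Ioc 0 T)), ∀ i j, ∀ v : QPoly k,
    (∫ x in M.cell i j, caputoSubst α (κ x) (fun τ => ev (u τ i j) x) t * ev v x)
      + (∫ x in M.cell i j, (ev (p t i j) x * ev (dx v) x + ev (q t i j) x * ev (dy v) x))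
      - edgeTerm M (1 - σ₁) (1 - σ₂) (p t) (q t) i j v v = 0
  /-- `((p,q), w) + (u, ∇·w) - ⟨û, w·n⟩ = 0` on every element. -/
  gradient : ∀ᵐ t ∂(volume.restrict (Ioc 0 T)), ∀ i j, ∀ w₁ w₂ : QPoly k,
    (∫ x in M.cell i j, (ev (p t i j) x * ev w₁ x + ev (q t i j) x * ev w₂ x))
      + (∫ x in M.cell i j, ev (u t i j) x * (ev (dx w₁) x + ev (dy w₂) x))
      - edgeTerm M σ₁ σ₂ (u t) (u t) i j w₁ w₂ = 0
  /-- `(u(0), v) = (u₀, v)` on every element. -/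
  initial : ∀ i j, ∀ v : QPoly k,
    (∫ x in M.cell i j, ev (u 0 i j) x * ev v x) = ∫ x in M.cell i j, u₀ x * ev v x

end

/-! ### The constants -/

/-- `C_α = (1/(α+1)) (απ/(α+1))^α min{C_max^{-(4+4α)}, 1}`. -/
noncomputable def constAlpha (α Cmax : ℝ) : ℝ :=
  1 / (α + 1) * (α * Real.pi / (α + 1)) ^ α * min (Cmax ^ (-(4 + 4 * α))) 1

/-- `C = sec²(πα/2) T max{C_max⁶, 1} / (C_α Γ(2-α))`. -/
noncomputable def stabilityConst (α T Cmax : ℝ) : ℝ :=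
  (1 / Real.cos (Real.pi * α / 2)) ^ 2 *
    (T * max (Cmax ^ 6) 1 / (constAlpha α Cmax * Real.Gamma (2 - α)))

end LDG

namespace LDG

/-! Testing the two equations with `u` and `(p, q)` and summing over the periodic mesh cancels all
volume and edge terms, because the two fluxes carry complementary weights (`sum_alternating_flux`,
`sum_volume_sub_edgeTerm`). What remains is that the substantial derivative does nonpositive work:
for almost every t, the integral of `(D^{α,κ} u) u` over the mesh equals `-‖(p, q)‖² ≤ 0`
(`IsSemidiscreteSolution.energy_nonpos`).

Nonpositive work controls a function by its initial value. For a decreasing kernel k with slope ρ =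
-k', integration by parts and Young's inequality give `2 W(t) ∫ k(t-τ) W'(τ) dτ ≥ k(0) W(t)² - k(t)
W(0)² - ∫ ρ(t-τ) W(τ)² dτ` (`shiftKer_energy`). With W = e^{κτ} u and κ ≥ -ℓ, multiplication by
e^{-2κt} leaves weights at most e^{2ℓ(t-τ)}, which are absorbed into F(t) = e^{-2ℓt} ‖u(t)‖². Since
ρ has mass k(0) - k(T) on (0,T), integrating in time cancels k(0) and leaves `k(T) ∫ F ≤ (∫ k)
F(0)`, that is, `∫ F ≤ T / (1 - α) F(0)` (`integral_le_of_forall_shiftKer`).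

For k(s) = s^{-α} the value k(0) is infinite and u is only absolutely continuous in time, so the
argument is run with (s + δ)^{-α}. The error is a convolution of the difference of the kernels with
a fixed integrable function; by Young's inequality its time integral vanishes as δ → 0. The choice
e^{2ℓT} = `Cmax ^ 2` gives the constant `Cmax ^ 2 * (T / (1 - α))`, which `le_stabilityConst`
compares with the stated one. -/

/-- The kernel `s^{-α}` regularized by a shift. -/
noncomputable def shiftKer (α δ s : ℝ) : ℝ := (s + δ) ^ (-α)

/-- Minus the derivative of `shiftKer`. -/
noncomputable def shiftKerSlope (α δ s : ℝ) : ℝ := α * (s + δ) ^ (-α - 1)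

/-! ### Quadratic lower bounds for convolutions with the regularized kernel. -/

section Kernel

variable {α δ t T : ℝ}

lemma shiftKer_pos (hδ : 0 < δ) {s : ℝ} (hs : 0 ≤ s) : 0 < shiftKer α δ s :=
  Real.rpow_pos_of_pos (by linarith) _

lemma shiftKerSlope_nonneg (hα : 0 < α) (hδ : 0 < δ) {s : ℝ} (hs : 0 ≤ s) :
    0 ≤ shiftKerSlope α δ s :=
  mul_nonneg hα.le (Real.rpow_nonneg (by linarith) _)

lemma hasDerivAt_shiftKer_sub (hδ : 0 < δ) {τ : ℝ} (hτ : τ ≤ t) :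
    HasDerivAt (fun τ => shiftKer α δ (t - τ)) (shiftKerSlope α δ (t - τ)) τ := by
  unfold shiftKer shiftKerSlope
  have h1 : HasDerivAt (fun τ => t - τ + δ) (-1) τ := by
    simpa using ((hasDerivAt_id τ).const_sub t).add_const δ
  convert! h1.rpow_const (p := -α) (Or.inl (by linarith)) using 1
  ring

lemma continuousOn_shiftKer (hδ : 0 < δ) : ContinuousOn (shiftKer α δ) (Icc 0 T) := by
  unfold shiftKer
  refine ContinuousOn.rpow_const (by fun_prop) fun x hx => Or.inl ?_
  linarith [hx.1]

lemma continuousOn_shiftKerSlope (hδ : 0 < δ) : ContinuousOn (shiftKerSlope α δ) (Icc 0 T) := by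
  unfold shiftKerSlope
  refine continuousOn_const.mul (ContinuousOn.rpow_const (by fun_prop) fun x hx => Or.inl ?_)
  linarith [hx.1]

lemma continuousOn_comp_sub {h : ℝ → ℝ} (hh : ContinuousOn h (Icc 0 t)) :
    ContinuousOn (fun τ => h (t - τ)) (Icc 0 t) :=
  hh.comp (by fun_prop) fun x hx => ⟨by linarith [hx.2], by linarith [hx.1]⟩

lemma absolutelyContinuousOnInterval_shiftKer_sub (hδ : 0 < δ) (ht : 0 ≤ t) :
    AbsolutelyContinuousOnInterval (fun τ => shiftKer α δ (t - τ)) 0 t := by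
  apply ContDiffOn.absolutelyContinuousOnInterval
  unfold shiftKer
  rw [uIcc_of_le ht]
  refine ContDiffOn.rpow_const_of_ne (by fun_prop) fun x hx => ?_
  linarith [hx.2]

lemma integral_shiftKerSlope_sub (hδ : 0 < δ) (ht : 0 ≤ t) :
    ∫ τ in (0 : ℝ)..t, shiftKerSlope α δ (t - τ) = shiftKer α δ 0 - shiftKer α δ t := by
  rw [intervalIntegral.integral_eq_sub_of_hasDerivAt
    (f := fun τ => shiftKer α δ (t - τ))]
  · simp
  · intro x hx
    rw [uIcc_of_le ht] at hx
    exact hasDerivAt_shiftKer_sub hδ hx.2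
  · apply ContinuousOn.intervalIntegrable
    rw [uIcc_of_le ht]
    exact continuousOn_comp_sub (continuousOn_shiftKerSlope hδ)

lemma integral_shiftKerSlope (hδ : 0 < δ) (ht : 0 ≤ t) :
    ∫ s in (0 : ℝ)..t, shiftKerSlope α δ s = shiftKer α δ 0 - shiftKer α δ t := by
  rw [← integral_shiftKerSlope_sub hδ ht, intervalIntegral.integral_comp_sub_left]
  simp

/-- The quadratic lower bound for convolutions with the regularized kernel. -/
theorem shiftKer_energy (hα : 0 < α) (hδ : 0 < δ) (ht : 0 ≤ t) {W : ℝ → ℝ}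
    (hW : AbsolutelyContinuousOnInterval W 0 t) :
    (shiftKer α δ 0 * W t ^ 2 - shiftKer α δ t * W 0 ^ 2
      - ∫ τ in (0 : ℝ)..t, shiftKerSlope α δ (t - τ) * W τ ^ 2) / 2
    ≤ W t * ∫ τ in (0 : ℝ)..t, shiftKer α δ (t - τ) * deriv W τ := by
  have hWc : ContinuousOn W (Icc 0 t) := by simpa [uIcc_of_le ht] using hW.continuousOn
  have hdc : ContinuousOn (fun τ => shiftKerSlope α δ (t - τ)) (Icc 0 t) :=
    continuousOn_comp_sub (continuousOn_shiftKerSlope hδ)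
  have hII : ∀ {h : ℝ → ℝ}, ContinuousOn h (Icc 0 t) → IntervalIntegrable h volume 0 t := by
    intro h hh
    apply ContinuousOn.intervalIntegrable
    rwa [uIcc_of_le ht]
  have hparts : ∫ τ in (0 : ℝ)..t, shiftKer α δ (t - τ) * deriv W τ
      = shiftKer α δ 0 * W t - shiftKer α δ t * W 0
        - ∫ τ in (0 : ℝ)..t, shiftKerSlope α δ (t - τ) * W τ := by
    rw [(absolutelyContinuousOnInterval_shiftKer_sub hδ ht).integral_mul_deriv_eq_deriv_mul hW]
    simp only [sub_self, sub_zero]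
    congr 1
    apply intervalIntegral.integral_congr
    intro τ hτ
    rw [uIcc_of_le ht] at hτ
    simp only [(hasDerivAt_shiftKer_sub (α := α) hδ hτ.2).deriv]
  -- Young's inequality 2 W(t) W(τ) ≤ W(t)² + W(τ)² under the slope, whose mass `shiftKer α δ 0 -
  -- shiftKer α δ t` uses up only part of the boundary term `2 * shiftKer α δ 0 * W t ^ 2`.
  have hamgm : 2 * W t * ∫ τ in (0 : ℝ)..t, shiftKerSlope α δ (t - τ) * W τ
      ≤ W t ^ 2 * (shiftKer α δ 0 - shiftKer α δ t)
        + ∫ τ in (0 : ℝ)..t, shiftKerSlope α δ (t - τ) * W τ ^ 2 := by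
    rw [← integral_shiftKerSlope_sub hδ ht, ← intervalIntegral.integral_const_mul,
      ← intervalIntegral.integral_const_mul, ← intervalIntegral.integral_add]
    · refine intervalIntegral.integral_mono_on ht ?_ ?_ ?_
      · exact hII (continuousOn_const.mul (hdc.mul hWc))
      · exact hII ((continuousOn_const.mul hdc).add (hdc.mul (hWc.pow 2)))
      · intro τ hτ
        have h0 := shiftKerSlope_nonneg (s := t - τ) hα hδ (by linarith [hτ.2])
        nlinarith [mul_nonneg h0 (sq_nonneg (W t - W τ))]
    · exact hII (continuousOn_const.mul hdc)
    · exact hII (hdc.mul (hWc.pow 2))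
  rw [hparts]
  have hkt := shiftKer_pos (α := α) hδ ht
  -- The leftover terms at weight `shiftKer α δ t` complete the square (W(t) - W(0))².
  nlinarith [mul_nonneg hkt.le (sq_nonneg (W t - W 0))]

lemma shiftKer_le_rpow (hα : 0 < α) (hδ : 0 < δ) {s : ℝ} (hs : 0 < s) :
    shiftKer α δ s ≤ s ^ (-α) :=
  Real.rpow_le_rpow_of_nonpos hs (by linarith) (by linarith)

/-- The lower bound for `f` times its Caputo substantial derivative, up to an error that vanishes
with the regularization. -/
theorem caputoSubst_energy (hα : 0 < α) (hα1 : α < 1) (hδ : 0 < δ) (ht : 0 < t) {f g : ℝ → ℝ}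
    {κ ℓ K D : ℝ} (hf : AbsolutelyContinuousOnInterval f 0 t) (hκ : |κ| ≤ K) (hℓ : -ℓ ≤ κ)
    (hD : |f t| ≤ D)
    (hfg : ∀ᵐ τ ∂(volume.restrict (Ioc 0 t)), |deriv f τ| + K * |f τ| ≤ g τ)
    (hg : IntervalIntegrable (fun τ => (t - τ) ^ (-α) * g τ) volume 0 t)
    (hg' : IntervalIntegrable g volume 0 t) :
    (shiftKer α δ 0 * f t ^ 2 - shiftKer α δ t * Real.exp (2 * ℓ * t) * f 0 ^ 2
      - ∫ τ in (0 : ℝ)..t, shiftKerSlope α δ (t - τ) * Real.exp (2 * ℓ * (t - τ)) * f τ ^ 2) / 2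
      - D * Real.exp (K * t) * ∫ τ in (0 : ℝ)..t, ((t - τ) ^ (-α) - shiftKer α δ (t - τ)) * g τ
    ≤ Real.Gamma (1 - α) * (caputoSubst α κ f t * f t) := by
  have hΓ : Real.Gamma (1 - α) ≠ 0 := (Real.Gamma_pos_of_pos (by linarith)).ne'
  set W : ℝ → ℝ := fun τ => Real.exp (κ * τ) * f τ with hWdef
  have hexp : AbsolutelyContinuousOnInterval (fun τ => Real.exp (κ * τ)) 0 t :=
    ContDiffOn.absolutelyContinuousOnInterval (by fun_prop)
  have hW : AbsolutelyContinuousOnInterval W 0 t := hexp.fun_mul hf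
  have hfc : ContinuousOn f (Icc 0 t) := by simpa [uIcc_of_le ht.le] using hf.continuousOn
  have hWc : ContinuousOn W (Icc 0 t) := by simpa [uIcc_of_le ht.le] using hW.continuousOn
  have hkc : ContinuousOn (fun τ => shiftKer α δ (t - τ)) (Icc 0 t) :=
    continuousOn_comp_sub (continuousOn_shiftKer hδ)
  have hdc : ContinuousOn (fun τ => shiftKerSlope α δ (t - τ)) (Icc 0 t) :=
    continuousOn_comp_sub (continuousOn_shiftKerSlope hδ)
  have hII : ∀ {h : ℝ → ℝ}, ContinuousOn h (Icc 0 t) → IntervalIntegrable h volume 0 t := by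
    intro h hh
    apply ContinuousOn.intervalIntegrable
    rwa [uIcc_of_le ht.le]
  have hK0 : 0 ≤ K := (abs_nonneg κ).trans hκ
  have hD0 : 0 ≤ D := (abs_nonneg _).trans hD
  -- a.e. bound of the derivative
  have hdW : ∀ᵐ τ ∂(volume.restrict (Ioc 0 t)),
      |deriv W τ| ≤ Real.exp (κ * τ) * g τ := by
    have had := hf.ae_differentiableAt
    rw [← ae_restrict_iff' measurableSet_uIcc, uIcc_of_le ht.le] at had
    have had' := ae_restrict_of_ae_restrict_of_subset Ioc_subset_Icc_self had
    filter_upwards [had', hfg] with τ hτ hτg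
    have h1 : HasDerivAt (fun τ => Real.exp (κ * τ)) (Real.exp (κ * τ) * κ) τ := by
      simpa using ((hasDerivAt_id τ).const_mul κ).exp
    have h2 : deriv W τ = Real.exp (κ * τ) * (deriv f τ + κ * f τ) := by
      rw [(h1.fun_mul hτ.hasDerivAt).deriv]; ring
    rw [h2, abs_mul, abs_of_pos (Real.exp_pos _)]
    refine mul_le_mul_of_nonneg_left ?_ (Real.exp_pos _).le
    refine (abs_add_le _ _).trans (le_trans ?_ hτg)
    rw [abs_mul]
    gcongr
  have hmW : AEStronglyMeasurable (deriv W) (volume.restrict (Ioc 0 t)) :=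
    (measurable_deriv W).aestronglyMeasurable
  have hmk : AEStronglyMeasurable (fun τ : ℝ => (t - τ) ^ (-α)) (volume.restrict (Ioc 0 t)) := by
    apply Measurable.aestronglyMeasurable
    fun_prop
  have hIW : IntervalIntegrable (fun τ => (t - τ) ^ (-α) * deriv W τ) volume 0 t := by
    have hb := (hg.continuousOn_mul (g := fun τ => Real.exp (κ * τ)) (by fun_prop))
    rw [intervalIntegrable_iff_integrableOn_Ioc_of_le ht.le] at hb ⊢
    refine Integrable.mono' hb (hmk.mul hmW) ?_
    filter_upwards [hdW, ae_restrict_mem measurableSet_Ioc] with τ hτ hm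
    have h0 : 0 ≤ (t - τ) ^ (-α) := Real.rpow_nonneg (by linarith [hm.2]) _
    rw [Real.norm_eq_abs, abs_mul, abs_of_nonneg h0]
    calc _ ≤ (t - τ) ^ (-α) * (Real.exp (κ * τ) * g τ) := by gcongr
      _ = _ := by ring
  have hIkW : IntervalIntegrable (fun τ => shiftKer α δ (t - τ) * deriv W τ) volume 0 t := by
    have := hW.intervalIntegrable_deriv.continuousOn_mul
      (g := fun τ => shiftKer α δ (t - τ)) (by rwa [uIcc_of_le ht.le])
    exact this
  have hIkg : IntervalIntegrable (fun τ => shiftKer α δ (t - τ) * g τ) volume 0 t :=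
    hg'.continuousOn_mul (g := fun τ => shiftKer α δ (t - τ)) (by rwa [uIcc_of_le ht.le])
  have hIdiff : IntervalIntegrable
      (fun τ => ((t - τ) ^ (-α) - shiftKer α δ (t - τ)) * g τ) volume 0 t := by
    simpa only [sub_mul] using hg.sub hIkg
  -- the regularization error
  have herr : |Real.exp (-κ * t) * ((∫ τ in (0 : ℝ)..t, (t - τ) ^ (-α) * deriv W τ)
        - ∫ τ in (0 : ℝ)..t, shiftKer α δ (t - τ) * deriv W τ)|
      ≤ Real.exp (K * t) * ∫ τ in (0 : ℝ)..t, ((t - τ) ^ (-α) - shiftKer α δ (t - τ)) * g τ := by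
    rw [← intervalIntegral.integral_sub hIW hIkW, ← intervalIntegral.integral_const_mul,
      ← intervalIntegral.integral_const_mul, ← Real.norm_eq_abs]
    refine intervalIntegral.norm_integral_le_of_norm_le ht.le ?_ (hIdiff.const_mul _)
    rw [← ae_restrict_iff' measurableSet_Ioc]
    -- At τ = t the singular kernel takes the default value `0 ^ (-α) = 0`, which lies below
    -- `shiftKer α δ 0`; this null point has to be discarded.
    have hne : ∀ᵐ τ ∂(volume.restrict (Ioc 0 t)), τ ≠ t :=
      ae_restrict_of_ae (by simp [ae_iff, measure_singleton])
    filter_upwards [hdW, hfg, ae_restrict_mem measurableSet_Ioc, hne] with τ hτ hτg hm hτt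
    have hlt : 0 < t - τ := by
      have := lt_of_le_of_ne hm.2 hτt
      linarith
    have h0 : 0 ≤ (t - τ) ^ (-α) - shiftKer α δ (t - τ) := by
      linarith [shiftKer_le_rpow hα hδ hlt]
    have hg0 : 0 ≤ g τ := le_trans (by positivity) hτg
    rw [← sub_mul, Real.norm_eq_abs, abs_mul, abs_mul, abs_of_nonneg h0,
      abs_of_pos (Real.exp_pos _)]
    have hE : Real.exp (-κ * t) * Real.exp (κ * τ) ≤ Real.exp (K * t) := by
      rw [← Real.exp_add]
      apply Real.exp_le_exp.2
      have h1 := (abs_le.1 hκ).1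
      nlinarith [hm.1]
    calc _ ≤ Real.exp (-κ * t) * (((t - τ) ^ (-α) - shiftKer α δ (t - τ))
          * (Real.exp (κ * τ) * g τ)) := by gcongr
      _ = (Real.exp (-κ * t) * Real.exp (κ * τ)) *
          (((t - τ) ^ (-α) - shiftKer α δ (t - τ)) * g τ) := by ring
      _ ≤ _ := by gcongr
  have hmain := shiftKer_energy hα hδ ht.le hW
  have hcap : Real.Gamma (1 - α) * (caputoSubst α κ f t * f t)
      = f t * (Real.exp (-κ * t) * ∫ τ in (0 : ℝ)..t, (t - τ) ^ (-α) * deriv W τ) := by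
    rw [caputoSubst, caputo]
    field_simp
    rw [mul_comm]
  -- removal of the exponentials
  have hexp_le : ∀ τ ∈ Icc 0 t, Real.exp (-κ * t) ^ 2 * W τ ^ 2
      ≤ Real.exp (2 * ℓ * (t - τ)) * f τ ^ 2 := by
    intro τ hτ
    have : Real.exp (-κ * t) ^ 2 * W τ ^ 2 = Real.exp (-2 * κ * (t - τ)) * f τ ^ 2 := by
      rw [hWdef]
      have : Real.exp (-2 * κ * (t - τ)) = Real.exp (-κ * t) ^ 2 * Real.exp (κ * τ) ^ 2 := by
        rw [← Real.exp_nat_mul, ← Real.exp_nat_mul, ← Real.exp_add]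
        congr 1
        push_cast
        ring
      rw [this]
      ring
    rw [this]
    refine mul_le_mul_of_nonneg_right (Real.exp_le_exp.2 ?_) (sq_nonneg _)
    nlinarith [hτ.2]
  -- At τ = t the exponentials cancel exactly, so the leading positive term is kept without loss;
  -- only the terms to be subtracted pick up e^{2ℓ(t-τ)}.
  have hft : Real.exp (-κ * t) * W t = f t := by
    rw [hWdef]
    simp only
    rw [← mul_assoc, ← Real.exp_add]
    simp
  have hlow : (shiftKer α δ 0 * f t ^ 2 - shiftKer α δ t * Real.exp (2 * ℓ * t) * f 0 ^ 2
      - ∫ τ in (0 : ℝ)..t, shiftKerSlope α δ (t - τ) * Real.exp (2 * ℓ * (t - τ)) * f τ ^ 2) / 2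
      ≤ f t * (Real.exp (-κ * t) * ∫ τ in (0 : ℝ)..t, shiftKer α δ (t - τ) * deriv W τ) := by
    have h1 := mul_le_mul_of_nonneg_left hmain (sq_nonneg (Real.exp (-κ * t)))
    have h2 : Real.exp (-κ * t) ^ 2 * (W t * ∫ τ in (0 : ℝ)..t, shiftKer α δ (t - τ) * deriv W τ)
        = f t * (Real.exp (-κ * t) * ∫ τ in (0 : ℝ)..t, shiftKer α δ (t - τ) * deriv W τ) := by
      rw [← hft]; ring
    rw [h2] at h1
    refine le_trans ?_ h1
    have h3 := mul_le_mul_of_nonneg_left (hexp_le 0 ⟨le_rfl, ht.le⟩)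
      (shiftKer_pos (α := α) hδ ht.le).le
    have h4 : Real.exp (-κ * t) ^ 2 * ∫ τ in (0 : ℝ)..t, shiftKerSlope α δ (t - τ) * W τ ^ 2
        ≤ ∫ τ in (0 : ℝ)..t,
          shiftKerSlope α δ (t - τ) * Real.exp (2 * ℓ * (t - τ)) * f τ ^ 2 := by
      rw [← intervalIntegral.integral_const_mul]
      refine intervalIntegral.integral_mono_on ht.le ?_ ?_ ?_
      · exact hII (continuousOn_const.mul (hdc.mul (hWc.pow 2)))
      · exact hII ((hdc.mul (by fun_prop)).mul (hfc.pow 2))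
      · intro τ hτ
        have h0 := shiftKerSlope_nonneg (s := t - τ) hα hδ (by linarith [hτ.2])
        have := mul_le_mul_of_nonneg_left (hexp_le τ hτ) h0
        linarith
    have h5 : Real.exp (-κ * t) ^ 2 * (shiftKer α δ 0 * W t ^ 2) = shiftKer α δ 0 * f t ^ 2 := by
      rw [← hft]; ring
    rw [sub_zero] at h3
    linarith
  rw [hcap]
  have hprod : -(D * (Real.exp (K * t) *
        ∫ τ in (0 : ℝ)..t, ((t - τ) ^ (-α) - shiftKer α δ (t - τ)) * g τ))
      ≤ f t * (Real.exp (-κ * t) * ((∫ τ in (0 : ℝ)..t, (t - τ) ^ (-α) * deriv W τ)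
        - ∫ τ in (0 : ℝ)..t, shiftKer α δ (t - τ) * deriv W τ)) := by
    refine neg_le_of_abs_le ?_
    rw [abs_mul]
    exact mul_le_mul hD herr (abs_nonneg _) hD0
  linarith

end Kernel

/-! ### Causal convolutions of integrable functions on (0,T]. -/

section Convolution

variable {T : ℝ} {a b : ℝ → ℝ}

/-- Extension by zero turns the integral into a convolution of two integrable functions on the line,
which exists for almost every t. -/
lemma ae_intervalIntegrable_comp_sub_mul (ha : IntegrableOn a (Ioc 0 T))
    (hb : IntegrableOn b (Ioc 0 T)) :
    ∀ᵐ t ∂(volume.restrict (Ioc 0 T)),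
      IntervalIntegrable (fun τ => a (t - τ) * b τ) volume 0 t := by
  have hA := ha.integrable_indicator measurableSet_Ioc
  have hB := hb.integrable_indicator measurableSet_Ioc
  rw [ae_restrict_iff' measurableSet_Ioc]
  filter_upwards [hB.ae_convolution_exists (ContinuousLinearMap.mul ℝ ℝ) hA] with t ht htT
  rw [intervalIntegrable_iff_integrableOn_Ioo_of_le htT.1.le]
  refine IntegrableOn.congr_fun (ConvolutionExistsAt.integrable ht).integrableOn ?_
    measurableSet_Ioo
  intro τ hτ
  have h1 : τ ∈ Ioc 0 T := ⟨hτ.1, hτ.2.le.trans htT.2⟩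
  have h2 : t - τ ∈ Ioc 0 T := ⟨by linarith [hτ.2], by linarith [hτ.1, htT.2]⟩
  simp [indicator_of_mem h1, indicator_of_mem h2, mul_comm]

lemma convolution_indicator_eq (t : ℝ) (ht : t ∈ Ioc 0 T) :
    convolution ((Ioc 0 T).indicator b) ((Ioc 0 T).indicator a) (ContinuousLinearMap.mul ℝ ℝ)
      volume t = ∫ τ in (0 : ℝ)..t, a (t - τ) * b τ := by
  rw [convolution_def, intervalIntegral.integral_of_le ht.1.le, integral_Ioc_eq_integral_Ioo,
    ← integral_indicator measurableSet_Ioo]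
  congr 1
  ext τ
  by_cases hτ : τ ∈ Ioo 0 t
  · have h1 : τ ∈ Ioc 0 T := ⟨hτ.1, hτ.2.le.trans ht.2⟩
    have h2 : t - τ ∈ Ioc 0 T := ⟨by linarith [hτ.2], by linarith [hτ.1, ht.2]⟩
    simp [indicator_of_mem h1, indicator_of_mem h2, indicator_of_mem hτ, mul_comm]
  · rw [indicator_of_notMem hτ]
    by_cases h1 : τ ∈ Ioc 0 T
    · have h2 : t - τ ∉ Ioc 0 T := fun h => hτ ⟨h1.1, by linarith [h.1]⟩
      simp [indicator_of_notMem h2]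
    · simp [indicator_of_notMem h1]

lemma integrableOn_integral_comp_sub_mul (ha : IntegrableOn a (Ioc 0 T))
    (hb : IntegrableOn b (Ioc 0 T)) :
    IntegrableOn (fun t => ∫ τ in (0 : ℝ)..t, a (t - τ) * b τ) (Ioc 0 T) := by
  have hA := ha.integrable_indicator measurableSet_Ioc
  have hB := hb.integrable_indicator measurableSet_Ioc
  exact IntegrableOn.congr_fun
    (hB.integrable_convolution (ContinuousLinearMap.mul ℝ ℝ) hA).integrableOn
    (fun t ht => convolution_indicator_eq t ht) measurableSet_Ioc

/-- Young's inequality in `L¹` for causal convolutions of nonnegative functions. -/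
lemma integral_integral_comp_sub_mul_le (ha : IntegrableOn a (Ioc 0 T))
    (hb : IntegrableOn b (Ioc 0 T)) (ha0 : ∀ s ∈ Ioc 0 T, 0 ≤ a s)
    (hb0 : ∀ s ∈ Ioc 0 T, 0 ≤ b s) :
    ∫ t in Ioc 0 T, (∫ τ in (0 : ℝ)..t, a (t - τ) * b τ)
      ≤ (∫ s in Ioc 0 T, a s) * ∫ s in Ioc 0 T, b s := by
  have hA := ha.integrable_indicator measurableSet_Ioc
  have hB := hb.integrable_indicator measurableSet_Ioc
  have hA0 : ∀ s, 0 ≤ (Ioc 0 T).indicator a s := indicator_nonneg ha0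
  have hB0 : ∀ s, 0 ≤ (Ioc 0 T).indicator b s := indicator_nonneg hb0
  rw [← setIntegral_congr_fun measurableSet_Ioc (fun t ht => convolution_indicator_eq t ht)]
  -- The convolution of the zero extensions may have mass beyond T; nonnegativity allows it to be
  -- added, and the integral over the whole line then factors.
  refine (setIntegral_le_integral
    (hB.integrable_convolution (ContinuousLinearMap.mul ℝ ℝ) hA) ?_).trans ?_
  · refine Filter.Eventually.of_forall fun t => ?_
    rw [convolution_def]
    exact integral_nonneg fun s => mul_nonneg (hB0 s) (hA0 _)
  · rw [integral_convolution _ hB hA, integral_indicator measurableSet_Ioc,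
      integral_indicator measurableSet_Ioc]
    simp [mul_comm]

end Convolution

/-! ### Time integration of the Volterra inequality and removal of the regularization. -/

section Volterra

variable {α T : ℝ}

lemma integral_shiftKer (hα1 : α < 1) {δ : ℝ} (hT : 0 ≤ T) :
    ∫ s in Ioc 0 T, shiftKer α δ s = ((T + δ) ^ (1 - α) - δ ^ (1 - α)) / (1 - α) := by
  rw [← intervalIntegral.integral_of_le hT]
  unfold shiftKer
  rw [intervalIntegral.integral_comp_add_right (fun s => s ^ (-α)), integral_rpow
    (Or.inl (by linarith))]
  simp only [zero_add]
  ring_nf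

lemma integrableOn_rpow_neg (hα1 : α < 1) (hT : 0 ≤ T) :
    IntegrableOn (fun s : ℝ => s ^ (-α)) (Ioc 0 T) := by
  rw [← intervalIntegrable_iff_integrableOn_Ioc_of_le hT]
  exact intervalIntegral.intervalIntegrable_rpow' (by linarith)

/-- A stability estimate for a family of regularized Volterra inequalities. -/
theorem integral_le_of_forall_shiftKer (hα : 0 < α) (hα1 : α < 1) (hT : 0 < T) {F g : ℝ → ℝ}
    (hF : ContinuousOn F (Icc 0 T)) (hF0 : ∀ t ∈ Icc 0 T, 0 ≤ F t)
    (hg : IntegrableOn g (Ioc 0 T)) (hg0 : ∀ t ∈ Ioc 0 T, 0 ≤ g t)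
    (h : ∀ δ > 0, ∀ᵐ t ∂(volume.restrict (Ioc 0 T)),
      shiftKer α δ 0 * F t - shiftKer α δ t * F 0
        - (∫ τ in (0 : ℝ)..t, shiftKerSlope α δ (t - τ) * F τ)
      ≤ ∫ τ in (0 : ℝ)..t, ((t - τ) ^ (-α) - shiftKer α δ (t - τ)) * g τ) :
    ∫ t in (0 : ℝ)..T, F t ≤ T / (1 - α) * F 0 := by
  have hFi : IntegrableOn F (Ioc 0 T) :=
    (hF.integrableOn_compact isCompact_Icc).mono_set Ioc_subset_Icc_self
  rw [intervalIntegral.integral_of_le hT.le]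
  set I := ∫ t in Ioc 0 T, F t with hI
  set J := ∫ t in Ioc 0 T, g t with hJ
  -- The inequality is integrated over (0,T]. The slope contributes at most `(shiftKer α δ 0 -
  -- shiftKer α δ T) * I`, so the value at 0, which blows up as δ → 0, drops out and `shiftKer α δ T
  -- * I` survives. The last summand is the difference of the kernel masses times J.
  have key : ∀ δ > 0, (T + δ) ^ (-α) * I
      ≤ ((T + δ) ^ (1 - α) - δ ^ (1 - α)) / (1 - α) * F 0
        + (T ^ (1 - α) / (1 - α) - ((T + δ) ^ (1 - α) - δ ^ (1 - α)) / (1 - α)) * J := by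
    intro δ hδ
    have hki : IntegrableOn (shiftKer α δ) (Ioc 0 T) :=
      ((continuousOn_shiftKer hδ).integrableOn_compact isCompact_Icc).mono_set Ioc_subset_Icc_self
    have hdi : IntegrableOn (shiftKerSlope α δ) (Ioc 0 T) :=
      ((continuousOn_shiftKerSlope hδ).integrableOn_compact isCompact_Icc).mono_set
        Ioc_subset_Icc_self
    have hri := integrableOn_rpow_neg hα1 hT.le
    have hei : IntegrableOn (fun s : ℝ => s ^ (-α) - shiftKer α δ s) (Ioc 0 T) := hri.sub hki
    have hli : IntegrableOn (fun t => shiftKer α δ 0 * F t - shiftKer α δ t * F 0) (Ioc 0 T) :=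
      (hFi.const_mul (shiftKer α δ 0)).sub (hki.mul_const (F 0))
    have h1 := integral_mono_ae (hli.sub (integrableOn_integral_comp_sub_mul hdi hFi))
      (integrableOn_integral_comp_sub_mul hei hg) (h δ hδ)
    rw [integral_sub' hli (integrableOn_integral_comp_sub_mul hdi hFi),
      integral_sub (hFi.const_mul (shiftKer α δ 0)) (hki.mul_const (F 0)), integral_const_mul,
      integral_mul_const] at h1
    have h2 := integral_integral_comp_sub_mul_le hdi hFi
      (fun s hs => shiftKerSlope_nonneg hα hδ hs.1.le) (fun s hs => hF0 s ⟨hs.1.le, hs.2⟩)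
    have h3 := integral_integral_comp_sub_mul_le hei hg
      (fun s hs => by linarith [shiftKer_le_rpow hα hδ hs.1]) hg0
    rw [← intervalIntegral.integral_of_le hT.le (f := shiftKerSlope α δ),
      integral_shiftKerSlope hδ hT.le] at h2
    rw [integral_sub hri hki] at h3
    -- The mass formula does not need δ > 0; at δ = 0 it gives the mass of the singular kernel.
    have h4 := integral_shiftKer hα1 hT.le (δ := 0)
    simp only [shiftKer, add_zero] at h4
    rw [Real.zero_rpow (by linarith), sub_zero] at h4
    rw [h4, integral_shiftKer hα1 hT.le] at h3
    rw [integral_shiftKer hα1 hT.le] at h1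
    have h5 : (T + δ) ^ (-α) = shiftKer α δ T := rfl
    rw [h5]
    linarith
  have hlim : T ^ (-α) * I ≤ T ^ (1 - α) / (1 - α) * F 0 := by
    have c1 : ContinuousAt (fun δ : ℝ => (T + δ) ^ (-α) * I) 0 :=
      (ContinuousAt.rpow_const (by fun_prop) (Or.inl (by simpa using hT.ne'))).mul
        continuousAt_const
    have c2 : ContinuousAt (fun δ : ℝ => ((T + δ) ^ (1 - α) - δ ^ (1 - α)) / (1 - α)) 0 :=
      ((ContinuousAt.rpow_const (by fun_prop) (Or.inr (by linarith))).sub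
        (ContinuousAt.rpow_const (by fun_prop) (Or.inr (by linarith)))).div_const _
    have c3 : ContinuousAt (fun δ : ℝ => ((T + δ) ^ (1 - α) - δ ^ (1 - α)) / (1 - α) * F 0
        + (T ^ (1 - α) / (1 - α) - ((T + δ) ^ (1 - α) - δ ^ (1 - α)) / (1 - α)) * J) 0 :=
      (c2.mul continuousAt_const).add ((continuousAt_const.sub c2).mul continuousAt_const)
    have t1 := c1.tendsto.mono_left (nhdsWithin_le_nhds (s := Ioi 0))
    have t2 := c3.tendsto.mono_left (nhdsWithin_le_nhds (s := Ioi 0))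
    have := le_of_tendsto_of_tendsto t1 t2
      (by filter_upwards [self_mem_nhdsWithin] with δ hδ using key δ hδ)
    simpa [Real.zero_rpow (show (1 - α) ≠ 0 by linarith)] using this
  have hsplit : T ^ (1 - α) = T ^ (-α) * T := by
    rw [show (1 - α) = -α + 1 by ring, Real.rpow_add_one hT.ne']
  rw [hsplit] at hlim
  have hp : 0 < T ^ (-α) := Real.rpow_pos_of_pos hT _
  refine le_of_mul_le_mul_left ?_ hp
  calc _ ≤ _ := hlim
    _ = _ := by ring

end Volterra

/-! ### Integration in space for functions with finitely many space modes and a measurable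
potential. -/

section Separated

variable {X ι : Type*} [MeasurableSpace X] {μ : Measure X} {S : Finset ι}
  {e : ι → X → ℝ} {c : ι → ℝ → ℝ} {κ : X → ℝ} {α δ t K B D ℓ : ℝ} {g : ℝ → ℝ}

/-- The potential is only measurable, so the history integrals depend on x through e^{κ(x)τ} without
any regularity. Joint measurability and the bound e^{Kt} ∫ |a| suffice. -/
lemma memLp_top_integral_mul_exp [IsFiniteMeasure μ] {a : ℝ → ℝ} (ht : 0 ≤ t)
    (ha : IntervalIntegrable a volume 0 t)
    (hκ : AEMeasurable κ μ) (hκK : ∀ᵐ x ∂μ, |κ x| ≤ K) :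
    MemLp (fun x => ∫ τ in (0 : ℝ)..t, a τ * Real.exp (κ x * τ)) ⊤ μ := by
  rw [intervalIntegrable_iff_integrableOn_Ioc_of_le ht] at ha
  have hm : AEStronglyMeasurable (fun x => ∫ τ in (0 : ℝ)..t, a τ * Real.exp (κ x * τ)) μ := by
    simp only [intervalIntegral.integral_of_le ht]
    have h1 : AEStronglyMeasurable (fun z : X × ℝ => a z.2 * Real.exp (κ z.1 * z.2))
        (μ.prod (volume.restrict (Ioc 0 t))) := by
      refine (ha.aestronglyMeasurable.comp_snd).mul ?_
      apply AEMeasurable.aestronglyMeasurable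
      exact Real.measurable_exp.comp_aemeasurable
        ((hκ.comp_fst).mul measurable_snd.aemeasurable)
    exact h1.integral_prod_right'
  refine memLp_top_of_bound hm ((∫ τ in (0 : ℝ)..t, |a τ|) * Real.exp (K * t)) ?_
  filter_upwards [hκK] with x hx
  rw [← intervalIntegral.integral_mul_const]
  refine intervalIntegral.norm_integral_le_of_norm_le ht ?_ ?_
  · refine Filter.Eventually.of_forall fun τ hτ => ?_
    rw [Real.norm_eq_abs, abs_mul, abs_of_pos (Real.exp_pos _)]
    refine mul_le_mul_of_nonneg_left (Real.exp_le_exp.2 ?_) (abs_nonneg _)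
    have h1 := le_abs_self (κ x)
    have h2 := abs_nonneg (κ x)
    nlinarith [hτ.1, hτ.2]
  · rw [intervalIntegrable_iff_integrableOn_Ioc_of_le ht]
    exact ha.abs.mul_const _

lemma absolutelyContinuousOnInterval_sum {a b : ℝ}
    (hc : ∀ m ∈ S, AbsolutelyContinuousOnInterval (c m) a b) (y : ι → ℝ) :
    AbsolutelyContinuousOnInterval (fun τ => ∑ m ∈ S, c m τ * y m) a b := by
  classical
  induction S using Finset.induction_on with
  | empty =>
    simp only [Finset.sum_empty]
    exact ContDiffOn.absolutelyContinuousOnInterval contDiffOn_const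
  | insert m S hm ih =>
    simp only [Finset.sum_insert hm]
    refine AbsolutelyContinuousOnInterval.fun_add ?_ (ih fun m' h => hc m' (by simp [h]))
    have := (hc m (by simp)).const_mul (y m)
    simpa only [mul_comm] using this

lemma ae_differentiableAt_of_absolutelyContinuous (ht : 0 ≤ t)
    (hc : ∀ m ∈ S, AbsolutelyContinuousOnInterval (c m) 0 t) :
    ∀ᵐ τ ∂(volume.restrict (Ioc 0 t)), ∀ m ∈ S, DifferentiableAt ℝ (c m) τ := by
  rw [Finset.eventually_all]
  intro m hm
  have had := (hc m hm).ae_differentiableAt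
  rw [← ae_restrict_iff' measurableSet_uIcc, uIcc_of_le ht] at had
  exact ae_restrict_of_ae_restrict_of_subset Ioc_subset_Icc_self had

lemma intervalIntegrable_rpow_mul_of_abs_le {a : ℝ → ℝ} (ht : 0 ≤ t)
    (hg : IntervalIntegrable (fun τ => (t - τ) ^ (-α) * g τ) volume 0 t)
    (ha : AEStronglyMeasurable a (volume.restrict (Ioc 0 t)))
    (hag : ∀ τ ∈ Ioc 0 t, |a τ| ≤ g τ) :
    IntervalIntegrable (fun τ => (t - τ) ^ (-α) * a τ) volume 0 t := by
  rw [intervalIntegrable_iff_integrableOn_Ioc_of_le ht] at hg ⊢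
  have hmk : AEStronglyMeasurable (fun τ : ℝ => (t - τ) ^ (-α)) (volume.restrict (Ioc 0 t)) := by
    apply Measurable.aestronglyMeasurable
    fun_prop
  refine Integrable.mono' hg (hmk.mul ha) ?_
  filter_upwards [ae_restrict_mem measurableSet_Ioc] with τ hm
  have h0 : 0 ≤ (t - τ) ^ (-α) := Real.rpow_nonneg (by linarith [hm.2]) _
  rw [Real.norm_eq_abs, abs_mul, abs_of_nonneg h0]
  exact mul_le_mul_of_nonneg_left (hag τ hm) h0

lemma abs_le_of_mul_sum_le (hK : 0 ≤ K) (hB : 1 ≤ B) {x y : ι → ℝ} {G : ℝ}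
    (h : B * ∑ m ∈ S, (|x m| + K * |y m|) ≤ G) {m : ι} (hm : m ∈ S) : |x m| ≤ G := by
  have h0 : ∀ m ∈ S, 0 ≤ |x m| + K * |y m| := fun m _ => by positivity
  have h1 := Finset.single_le_sum h0 hm
  have h2 : 0 ≤ K * |y m| := by positivity
  have h3 := Finset.sum_nonneg h0
  nlinarith

/-- The Caputo substantial derivative of a function with finitely many space modes, tested with
such a function, is integrable in space. -/
theorem integrable_caputoSubst_mul [IsFiniteMeasure μ] (hα1 : α < 1) (ht : 0 < t) (hK : 0 ≤ K)
    (hB : 1 ≤ B) (hc : ∀ m ∈ S, AbsolutelyContinuousOnInterval (c m) 0 t)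
    (he : ∀ m ∈ S, AEStronglyMeasurable (e m) μ) (heB : ∀ᵐ x ∂μ, ∀ m ∈ S, |e m x| ≤ B)
    (hκ : AEMeasurable κ μ) (hκK : ∀ᵐ x ∂μ, |κ x| ≤ K)
    (hcg : ∀ τ ∈ Ioc 0 t, B * ∑ m ∈ S, (|deriv (c m) τ| + K * |c m τ|) ≤ g τ)
    (hg : IntervalIntegrable (fun τ => (t - τ) ^ (-α) * g τ) volume 0 t) :
    Integrable (fun x => caputoSubst α (κ x) (fun τ => ∑ m ∈ S, c m τ * e m x) t
      * ∑ m ∈ S, c m t * e m x) μ := by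
  have heL : ∀ m ∈ S, MemLp (e m) ⊤ μ := fun m hm =>
    memLp_top_of_bound (he m hm) B (by filter_upwards [heB] with x hx using hx m hm)
  have hκL : MemLp κ ⊤ μ := memLp_top_of_bound hκ.aestronglyMeasurable K (by simpa using hκK)
  have hI1 : ∀ m ∈ S, IntervalIntegrable (fun τ => (t - τ) ^ (-α) * deriv (c m) τ) volume 0 t :=
    fun m hm => intervalIntegrable_rpow_mul_of_abs_le ht.le hg
      (measurable_deriv _).aestronglyMeasurable
      fun τ hτ => abs_le_of_mul_sum_le hK hB (hcg τ hτ) hm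
  have hrp : IntervalIntegrable (fun τ : ℝ => (t - τ) ^ (-α)) volume 0 t := by
    have h := (intervalIntegral.intervalIntegrable_rpow' (a := 0) (b := t) (r := -α)
      (by linarith)).comp_sub_left t
    simpa using h.symm
  have hI2 : ∀ m ∈ S, IntervalIntegrable (fun τ => (t - τ) ^ (-α) * c m τ) volume 0 t :=
    fun m hm => hrp.mul_continuousOn (hc m hm).continuousOn
  -- The product rule, valid for almost every τ, separates the space modes and leaves history
  -- integrals whose only dependence on x is through κ(x).
  have hform : ∀ x, ∫ τ in (0 : ℝ)..t, (t - τ) ^ (-α)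
        * deriv (fun τ => Real.exp (κ x * τ) * ∑ m ∈ S, c m τ * e m x) τ
      = ∑ m ∈ S, e m x *
        ((∫ τ in (0 : ℝ)..t, ((t - τ) ^ (-α) * deriv (c m) τ) * Real.exp (κ x * τ))
        + κ x * ∫ τ in (0 : ℝ)..t, ((t - τ) ^ (-α) * c m τ) * Real.exp (κ x * τ)) := by
    intro x
    have hJ1 : ∀ m ∈ S, IntervalIntegrable
        (fun τ => ((t - τ) ^ (-α) * deriv (c m) τ) * Real.exp (κ x * τ)) volume 0 t :=
      fun m hm => (hI1 m hm).mul_continuousOn (by fun_prop)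
    have hJ2 : ∀ m ∈ S, IntervalIntegrable
        (fun τ => ((t - τ) ^ (-α) * c m τ) * Real.exp (κ x * τ)) volume 0 t :=
      fun m hm => (hI2 m hm).mul_continuousOn (by fun_prop)
    have hsum : ∑ m ∈ S, e m x *
        ((∫ τ in (0 : ℝ)..t, ((t - τ) ^ (-α) * deriv (c m) τ) * Real.exp (κ x * τ))
        + κ x * ∫ τ in (0 : ℝ)..t, ((t - τ) ^ (-α) * c m τ) * Real.exp (κ x * τ))
        = ∫ τ in (0 : ℝ)..t, ∑ m ∈ S, e m x *
          (((t - τ) ^ (-α) * deriv (c m) τ) * Real.exp (κ x * τ)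
          + κ x * (((t - τ) ^ (-α) * c m τ) * Real.exp (κ x * τ))) := by
      rw [intervalIntegral.integral_finsetSum]
      · refine Finset.sum_congr rfl fun m hm => ?_
        rw [intervalIntegral.integral_const_mul, intervalIntegral.integral_add (hJ1 m hm)
          ((hJ2 m hm).const_mul _), intervalIntegral.integral_const_mul]
      · exact fun m hm => ((hJ1 m hm).add ((hJ2 m hm).const_mul _)).const_mul _
    rw [hsum]
    apply intervalIntegral.integral_congr_ae
    rw [uIoc_of_le ht.le, ← ae_restrict_iff' measurableSet_Ioc]
    filter_upwards [ae_differentiableAt_of_absolutelyContinuous ht.le hc] with τ hτ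
    have h1 : HasDerivAt (fun τ => Real.exp (κ x * τ)) (Real.exp (κ x * τ) * κ x) τ := by
      simpa using ((hasDerivAt_id τ).const_mul (κ x)).exp
    have h2 : HasDerivAt (fun τ => ∑ m ∈ S, c m τ * e m x)
        (∑ m ∈ S, deriv (c m) τ * e m x) τ :=
      HasDerivAt.fun_sum fun m hm => (hτ m hm).hasDerivAt.mul_const _
    rw [(h1.fun_mul h2).deriv, mul_add, Finset.mul_sum, Finset.mul_sum, Finset.mul_sum,
      Finset.mul_sum, ← Finset.sum_add_distrib]
    refine Finset.sum_congr rfl fun m _ => ?_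
    ring
  have hU : MemLp (fun x => ∑ m ∈ S, c m t * e m x) ⊤ μ :=
    memLp_finsetSum S fun m hm => (heL m hm).const_mul _
  have hP : MemLp (fun x => ∑ m ∈ S, e m x *
        ((∫ τ in (0 : ℝ)..t, ((t - τ) ^ (-α) * deriv (c m) τ) * Real.exp (κ x * τ))
        + κ x * ∫ τ in (0 : ℝ)..t, ((t - τ) ^ (-α) * c m τ) * Real.exp (κ x * τ))) ⊤ μ := by
    refine memLp_finsetSum S fun m hm => ?_
    have q1 := memLp_top_integral_mul_exp ht.le (hI1 m hm) hκ hκK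
    have q2 := memLp_top_integral_mul_exp ht.le (hI2 m hm) hκ hκK
    have q3 : MemLp (fun x => κ x *
        ∫ τ in (0 : ℝ)..t, ((t - τ) ^ (-α) * c m τ) * Real.exp (κ x * τ)) ⊤ μ :=
      q2.mul (p := ⊤) (q := ⊤) hκL
    exact (q1.add q3).mul (p := ⊤) (q := ⊤) (heL m hm)
  have hE : MemLp (fun x => Real.exp (-κ x * t)) ⊤ μ := by
    refine memLp_top_of_bound ?_ (Real.exp (K * t)) ?_
    · apply AEMeasurable.aestronglyMeasurable
      exact Real.measurable_exp.comp_aemeasurable (hκ.neg.mul_const t)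
    · filter_upwards [hκK] with x hx
      rw [Real.norm_eq_abs, abs_of_pos (Real.exp_pos _)]
      apply Real.exp_le_exp.2
      have := neg_abs_le (κ x)
      nlinarith
  have hfin : MemLp (fun x => (Real.exp (-κ x * t) * ((1 / Real.Gamma (1 - α)) *
      ∑ m ∈ S, e m x *
        ((∫ τ in (0 : ℝ)..t, ((t - τ) ^ (-α) * deriv (c m) τ) * Real.exp (κ x * τ))
        + κ x * ∫ τ in (0 : ℝ)..t, ((t - τ) ^ (-α) * c m τ) * Real.exp (κ x * τ))))
      * ∑ m ∈ S, c m t * e m x) ⊤ μ := by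
    have q1 : MemLp (fun x => (Real.exp (-κ x * t) * ((1 / Real.Gamma (1 - α)) *
      ∑ m ∈ S, e m x *
        ((∫ τ in (0 : ℝ)..t, ((t - τ) ^ (-α) * deriv (c m) τ) * Real.exp (κ x * τ))
        + κ x * ∫ τ in (0 : ℝ)..t, ((t - τ) ^ (-α) * c m τ) * Real.exp (κ x * τ))))) ⊤ μ :=
      (hP.const_mul _).mul (p := ⊤) (q := ⊤) hE
    exact hU.mul (p := ⊤) (q := ⊤) q1
  refine (hfin.integrable le_top).congr (Filter.Eventually.of_forall fun x => ?_)
  simp only [caputoSubst, caputo, hform]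

/-- Expanding the square gives a finite sum of products of a function of x and a function of τ; this
justifies Fubini's theorem for the history term. -/
lemma integrable_prod_mul_sq [SFinite μ] {w : ℝ → ℝ} (hw : ContinuousOn w (Icc 0 t))
    (hc : ∀ m ∈ S, ContinuousOn (c m) (Icc 0 t))
    (he : ∀ m ∈ S, MemLp (e m) 2 μ) :
    Integrable (fun z : X × ℝ => w z.2 * (∑ m ∈ S, c m z.2 * e m z.1) ^ 2)
      (μ.prod (volume.restrict (Ioc 0 t))) := by
  have : (fun z : X × ℝ => w z.2 * (∑ m ∈ S, c m z.2 * e m z.1) ^ 2)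
      = fun z => ∑ m ∈ S, ∑ n ∈ S, (e m z.1 * e n z.1) * (w z.2 * (c m z.2 * c n z.2)) := by
    ext z
    rw [sq, Finset.sum_mul_sum, Finset.mul_sum]
    refine Finset.sum_congr rfl fun m _ => ?_
    rw [Finset.mul_sum]
    refine Finset.sum_congr rfl fun n _ => ?_
    ring
  rw [this]
  refine integrable_finsetSum _ fun m hm => integrable_finsetSum _ fun n hn => ?_
  have h1 : Integrable (fun x => e m x * e n x) μ := (he m hm).integrable_mul (he n hn)
  have h2 : IntegrableOn (fun τ => w τ * (c m τ * c n τ)) (Ioc 0 t) :=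
    ((hw.mul ((hc m hm).mul (hc n hn))).integrableOn_compact isCompact_Icc).mono_set
      Ioc_subset_Icc_self
  exact h1.mul_prod h2

lemma continuousOn_integral_sq (hc : ∀ m ∈ S, ContinuousOn (c m) (Icc 0 t))
    (he : ∀ m ∈ S, MemLp (e m) 2 μ) :
    ContinuousOn (fun τ => ∫ x, (∑ m ∈ S, c m τ * e m x) ^ 2 ∂μ) (Icc 0 t) := by
  have : (fun τ => ∫ x, (∑ m ∈ S, c m τ * e m x) ^ 2 ∂μ)
      = fun τ => ∑ m ∈ S, ∑ n ∈ S, (c m τ * c n τ) * ∫ x, e m x * e n x ∂μ := by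
    ext τ
    have h1 : ∀ m ∈ S, ∀ n ∈ S, Integrable (fun x => (c m τ * c n τ) * (e m x * e n x)) μ :=
      fun m hm n hn => ((he m hm).integrable_mul (he n hn)).const_mul _
    simp only [← integral_const_mul]
    rw [← Finset.sum_congr rfl fun m hm => integral_finsetSum S (h1 m hm),
      ← integral_finsetSum S fun m hm => integrable_finsetSum S (h1 m hm)]
    congr 1
    ext x
    rw [sq, Finset.sum_mul_sum]
    refine Finset.sum_congr rfl fun m _ => Finset.sum_congr rfl fun n _ => ?_
    ring
  rw [this]
  exact continuousOn_finsetSum _ fun m hm => continuousOn_finsetSum _ fun n hn =>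
    ((hc m hm).mul (hc n hn)).mul continuousOn_const

/-- The energy inequality of `caputoSubst_energy` integrated over space. -/
theorem integral_caputoSubst_energy [IsFiniteMeasure μ] (hα : 0 < α) (hα1 : α < 1) (hδ : 0 < δ)
    (ht : 0 < t) (hK : 0 ≤ K)
    (hB : 1 ≤ B) (hc : ∀ m ∈ S, AbsolutelyContinuousOnInterval (c m) 0 t)
    (he : ∀ m ∈ S, AEStronglyMeasurable (e m) μ) (heB : ∀ᵐ x ∂μ, ∀ m ∈ S, |e m x| ≤ B)
    (hκ : AEMeasurable κ μ) (hκK : ∀ᵐ x ∂μ, |κ x| ≤ K) (hℓ : ∀ᵐ x ∂μ, -ℓ ≤ κ x)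
    (hD : ∑ m ∈ S, |c m t| ≤ D)
    (hcg : ∀ τ ∈ Ioc 0 t, B * ∑ m ∈ S, (|deriv (c m) τ| + K * |c m τ|) ≤ g τ)
    (hg : IntervalIntegrable (fun τ => (t - τ) ^ (-α) * g τ) volume 0 t)
    (hg' : IntervalIntegrable g volume 0 t) :
    (shiftKer α δ 0 * (∫ x, (∑ m ∈ S, c m t * e m x) ^ 2 ∂μ)
      - shiftKer α δ t * Real.exp (2 * ℓ * t) * (∫ x, (∑ m ∈ S, c m 0 * e m x) ^ 2 ∂μ)
      - ∫ τ in (0 : ℝ)..t, shiftKerSlope α δ (t - τ) * Real.exp (2 * ℓ * (t - τ))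
        * ∫ x, (∑ m ∈ S, c m τ * e m x) ^ 2 ∂μ) / 2
      - μ.real univ * (D * B * Real.exp (K * t) *
        ∫ τ in (0 : ℝ)..t, ((t - τ) ^ (-α) - shiftKer α δ (t - τ)) * g τ)
    ≤ Real.Gamma (1 - α) *
      ∫ x, caputoSubst α (κ x) (fun τ => ∑ m ∈ S, c m τ * e m x) t
        * (∑ m ∈ S, c m t * e m x) ∂μ := by
  have heL : ∀ m ∈ S, MemLp (e m) 2 μ := fun m hm =>
    MemLp.of_bound (he m hm) B (by filter_upwards [heB] with x hx using hx m hm)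
  have hcc : ∀ m ∈ S, ContinuousOn (c m) (Icc 0 t) := fun m hm => by
    simpa [uIcc_of_le ht.le] using (hc m hm).continuousOn
  have hw : ContinuousOn (fun τ => shiftKerSlope α δ (t - τ) * Real.exp (2 * ℓ * (t - τ)))
      (Icc 0 t) :=
    (continuousOn_comp_sub (continuousOn_shiftKerSlope hδ)).mul (by fun_prop)
  have hprod := integrable_prod_mul_sq hw hcc heL
  have hsq : ∀ τ, Integrable (fun x => (∑ m ∈ S, c m τ * e m x) ^ 2) μ := fun τ =>
    (memLp_finsetSum S fun m hm => (heL m hm).const_mul (c m τ)).integrable_sq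
  have hswap : ∫ x, (∫ τ in (0 : ℝ)..t, shiftKerSlope α δ (t - τ) * Real.exp (2 * ℓ * (t - τ))
        * (∑ m ∈ S, c m τ * e m x) ^ 2) ∂μ
      = ∫ τ in (0 : ℝ)..t, shiftKerSlope α δ (t - τ) * Real.exp (2 * ℓ * (t - τ))
        * ∫ x, (∑ m ∈ S, c m τ * e m x) ^ 2 ∂μ := by
    simp only [intervalIntegral.integral_of_le ht.le, ← integral_const_mul]
    exact integral_integral_swap hprod
  have hinner : Integrable (fun x => ∫ τ in (0 : ℝ)..t,
      shiftKerSlope α δ (t - τ) * Real.exp (2 * ℓ * (t - τ))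
        * (∑ m ∈ S, c m τ * e m x) ^ 2) μ := by
    simp only [intervalIntegral.integral_of_le ht.le]
    exact hprod.integral_prod_left
  -- Without integrability the Bochner integral would default to 0, and the pointwise inequality
  -- could not be integrated.
  have hI := integrable_caputoSubst_mul hα1 ht hK hB hc he heB hκ hκK hcg hg
  have hdiff := ae_differentiableAt_of_absolutelyContinuous ht.le hc
  rw [← hswap]
  have hl1 : Integrable (fun x => shiftKer α δ 0 * (∑ m ∈ S, c m t * e m x) ^ 2
      - shiftKer α δ t * Real.exp (2 * ℓ * t) * (∑ m ∈ S, c m 0 * e m x) ^ 2) μ :=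
    ((hsq t).const_mul _).sub ((hsq 0).const_mul _)
  have hl2 : Integrable (fun x => (shiftKer α δ 0 * (∑ m ∈ S, c m t * e m x) ^ 2
      - shiftKer α δ t * Real.exp (2 * ℓ * t) * (∑ m ∈ S, c m 0 * e m x) ^ 2
      - ∫ τ in (0 : ℝ)..t, shiftKerSlope α δ (t - τ) * Real.exp (2 * ℓ * (t - τ))
        * (∑ m ∈ S, c m τ * e m x) ^ 2) / 2) μ := (hl1.sub hinner).div_const 2
  set R := ∫ τ in (0 : ℝ)..t, ((t - τ) ^ (-α) - shiftKer α δ (t - τ)) * g τ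
  have hle : ∫ x, ((shiftKer α δ 0 * (∑ m ∈ S, c m t * e m x) ^ 2
      - shiftKer α δ t * Real.exp (2 * ℓ * t) * (∑ m ∈ S, c m 0 * e m x) ^ 2
      - ∫ τ in (0 : ℝ)..t, shiftKerSlope α δ (t - τ) * Real.exp (2 * ℓ * (t - τ))
        * (∑ m ∈ S, c m τ * e m x) ^ 2) / 2 - D * B * Real.exp (K * t) * R) ∂μ
      ≤ ∫ x, Real.Gamma (1 - α) *
        (caputoSubst α (κ x) (fun τ => ∑ m ∈ S, c m τ * e m x) t
        * ∑ m ∈ S, c m t * e m x) ∂μ := by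
    refine integral_mono_ae (hl2.sub (integrable_const _)) (hI.const_mul _) ?_
    filter_upwards [heB, hκK, hℓ] with x hxB hxK hxℓ
    have hB0 : 0 ≤ B := by linarith
    have hen := caputoSubst_energy (f := fun τ => ∑ m ∈ S, c m τ * e m x) (D := D * B) (g := g)
      hα hα1 hδ ht (absolutelyContinuousOnInterval_sum hc fun m => e m x) hxK hxℓ ?_ ?_ hg hg'
    · exact hen
    · calc |∑ m ∈ S, c m t * e m x| ≤ ∑ m ∈ S, |c m t * e m x| :=
            Finset.abs_sum_le_sum_abs _ _
        _ ≤ ∑ m ∈ S, |c m t| * B := by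
            refine Finset.sum_le_sum fun m hm => ?_
            rw [abs_mul]
            exact mul_le_mul_of_nonneg_left (hxB m hm) (abs_nonneg _)
        _ ≤ D * B := by
            rw [← Finset.sum_mul]
            gcongr
    · filter_upwards [hdiff, ae_restrict_mem measurableSet_Ioc] with τ hτ hτm
      have h2 : HasDerivAt (fun τ => ∑ m ∈ S, c m τ * e m x)
          (∑ m ∈ S, deriv (c m) τ * e m x) τ :=
        HasDerivAt.fun_sum fun m hm => (hτ m hm).hasDerivAt.mul_const _
      rw [h2.deriv]
      refine le_trans ?_ (hcg τ hτm)
      have bd : ∀ y : ι → ℝ, |∑ m ∈ S, y m * e m x| ≤ B * ∑ m ∈ S, |y m| := by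
        intro y
        refine (Finset.abs_sum_le_sum_abs _ _).trans ?_
        rw [Finset.mul_sum]
        refine Finset.sum_le_sum fun m hm => ?_
        rw [abs_mul, mul_comm]
        exact mul_le_mul_of_nonneg_right (hxB m hm) (abs_nonneg _)
      calc _ ≤ B * (∑ m ∈ S, |deriv (c m) τ|) + K * (B * ∑ m ∈ S, |c m τ|) := by
            gcongr
            · exact bd _
            · exact bd _
        _ = _ := by
            rw [Finset.sum_add_distrib, ← Finset.mul_sum]
            ring
  rw [integral_sub hl2 (integrable_const _), integral_div, integral_sub hl1 hinner,
    integral_sub ((hsq t).const_mul _) ((hsq 0).const_mul _), integral_const_mul,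
    integral_const_mul (shiftKer α δ t * Real.exp (2 * ℓ * t)), integral_const, smul_eq_mul,
    integral_const_mul (Real.Gamma (1 - α))] at hle
  exact hle

end Separated

/-! ### Evaluation and partial derivatives of polynomials in the plane. -/

section Polynomials

lemma continuous_ev (q : MvPolynomial (Fin 2) ℝ) : Continuous (ev q) := by
  unfold ev
  refine (MvPolynomial.continuous_eval q).comp (continuous_pi fun i => ?_)
  fin_cases i
  · exact continuous_fst
  · exact continuous_snd

lemma ev_add (p q : MvPolynomial (Fin 2) ℝ) (x : ℝ × ℝ) : ev (p + q) x = ev p x + ev q x := by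
  simp [ev]

lemma ev_mul (p q : MvPolynomial (Fin 2) ℝ) (x : ℝ × ℝ) : ev (p * q) x = ev p x * ev q x := by
  simp [ev]

lemma ev_dx_mul (p q : MvPolynomial (Fin 2) ℝ) (x : ℝ × ℝ) :
    ev (dx (p * q)) x = ev p x * ev (dx q) x + ev q x * ev (dx p) x := by
  simp only [dx, Derivation.leibniz, smul_eq_mul, ev_add, ev_mul]

lemma ev_dy_mul (p q : MvPolynomial (Fin 2) ℝ) (x : ℝ × ℝ) :
    ev (dy (p * q)) x = ev p x * ev (dy q) x + ev q x * ev (dy p) x := by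
  simp only [dy, Derivation.leibniz, smul_eq_mul, ev_add, ev_mul]

lemma hasDerivAt_ev_dx (q : MvPolynomial (Fin 2) ℝ) (x y : ℝ) :
    HasDerivAt (fun s => ev q (s, y)) (ev (dx q) (x, y)) x := by
  induction q using MvPolynomial.induction_on with
  | C a => simpa [ev, dx] using hasDerivAt_const x a
  | add p q hp hq =>
    simp only [ev_add, dx, map_add]
    exact hp.add hq
  | mul_X p n hp =>
    simp only [ev_dx_mul, ev_mul]
    have hX : HasDerivAt (fun s => ev (MvPolynomial.X n) (s, y))
        (ev (dx (MvPolynomial.X n)) (x, y)) x := by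
      fin_cases n
      · simpa [ev, dx] using hasDerivAt_id' x
      · simpa [ev, dx, MvPolynomial.pderiv_X] using hasDerivAt_const x y
    convert! hp.fun_mul hX using 1
    ring

lemma hasDerivAt_ev_dy (q : MvPolynomial (Fin 2) ℝ) (x y : ℝ) :
    HasDerivAt (fun s => ev q (x, s)) (ev (dy q) (x, y)) y := by
  induction q using MvPolynomial.induction_on with
  | C a => simpa [ev, dy] using hasDerivAt_const y a
  | add p q hp hq =>
    simp only [ev_add, dy, map_add]
    exact hp.add hq
  | mul_X p n hp =>
    simp only [ev_dy_mul, ev_mul]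
    have hX : HasDerivAt (fun s => ev (MvPolynomial.X n) (x, s))
        (ev (dy (MvPolynomial.X n)) (x, y)) y := by
      fin_cases n
      · simpa [ev, dy, MvPolynomial.pderiv_X] using hasDerivAt_const y x
      · simpa [ev, dy] using hasDerivAt_id' y
    convert! hp.fun_mul hX using 1
    ring

end Polynomials

/-! ### Green's formula on the cells and cancellation of the fluxes. -/

section Green

variable {Nx Ny k : ℕ} (M : RectMesh Nx Ny)

lemma RectMesh.xL_lt_xR (i : Fin Nx) : M.xL i < M.xR i :=
  M.xs_strictMono (Fin.castSucc_lt_succ)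

lemma RectMesh.yB_lt_yT (j : Fin Ny) : M.yB j < M.yT j :=
  M.ys_strictMono (Fin.castSucc_lt_succ)

lemma integrableOn_cell (i : Fin Nx) (j : Fin Ny) {f : ℝ × ℝ → ℝ} (hf : Continuous f) :
    IntegrableOn f (M.cell i j) :=
  (hf.continuousOn.integrableOn_compact
    (isCompact_Icc.prod isCompact_Icc : IsCompact (Icc (M.xL i) (M.xR i) ×ˢ
      Icc (M.yB j) (M.yT j)))).mono_set (prod_mono Ioo_subset_Icc_self Ioo_subset_Icc_self)

lemma setIntegral_cell (i : Fin Nx) (j : Fin Ny) {f : ℝ × ℝ → ℝ} (hf : Continuous f) :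
    ∫ z in M.cell i j, f z
      = ∫ x in (M.xL i)..(M.xR i), ∫ y in (M.yB j)..(M.yT j), f (x, y) := by
  have h := integrableOn_cell M i j hf
  unfold RectMesh.cell at h ⊢
  rw [Measure.volume_eq_prod] at h ⊢
  rw [setIntegral_prod _ h, intervalIntegral.integral_of_le (M.xL_lt_xR i).le,
    integral_Ioc_eq_integral_Ioo]
  congr 1
  ext x
  rw [intervalIntegral.integral_of_le (M.yB_lt_yT j).le, integral_Ioc_eq_integral_Ioo]

lemma setIntegral_cell_swap (i : Fin Nx) (j : Fin Ny) {f : ℝ × ℝ → ℝ} (hf : Continuous f) :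
    ∫ z in M.cell i j, f z
      = ∫ y in (M.yB j)..(M.yT j), ∫ x in (M.xL i)..(M.xR i), f (x, y) := by
  rw [setIntegral_cell M i j hf]
  simp only [intervalIntegral.integral_of_le (M.xL_lt_xR i).le,
    intervalIntegral.integral_of_le (M.yB_lt_yT j).le]
  refine integral_integral_swap ?_
  rw [Measure.prod_restrict]
  exact (hf.continuousOn.integrableOn_compact (μ := volume.prod volume)
    (isCompact_Icc.prod isCompact_Icc : IsCompact (Icc (M.xL i) (M.xR i) ×ˢ
      Icc (M.yB j) (M.yT j)))).mono_set (prod_mono Ioc_subset_Icc_self Ioc_subset_Icc_self)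

lemma setIntegral_cell_dx (i : Fin Nx) (j : Fin Ny) (q : MvPolynomial (Fin 2) ℝ) :
    ∫ z in M.cell i j, ev (dx q) z
      = ∫ y in (M.yB j)..(M.yT j), (ev q (M.xR i, y) - ev q (M.xL i, y)) := by
  rw [setIntegral_cell_swap M i j (continuous_ev _)]
  congr 1
  ext y
  exact intervalIntegral.integral_eq_sub_of_hasDerivAt (fun x _ => hasDerivAt_ev_dx q x y)
    (((continuous_ev (dx q)).comp (by fun_prop : Continuous fun x : ℝ => (x, y))).intervalIntegrable
      _ _)

lemma setIntegral_cell_dy (i : Fin Nx) (j : Fin Ny) (q : MvPolynomial (Fin 2) ℝ) :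
    ∫ z in M.cell i j, ev (dy q) z
      = ∫ x in (M.xL i)..(M.xR i), (ev q (x, M.yT j) - ev q (x, M.yB j)) := by
  rw [setIntegral_cell M i j (continuous_ev _)]
  congr 1
  ext x
  exact intervalIntegral.integral_eq_sub_of_hasDerivAt (fun y _ => hasDerivAt_ev_dy q x y)
    (((continuous_ev (dy q)).comp (by fun_prop : Continuous fun y : ℝ => (x, y))).intervalIntegrable
      _ _)

/-- Generalized alternating fluxes with complementary weights conserve energy on a cycle. -/
lemma sum_alternating_flux {n : ℕ} [NeZero n] (σ : ℝ) (a b c d : Fin n → ℝ) :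
    ∑ i, (((1 - σ) * a i + (1 - (1 - σ)) * b (i + 1)) * c i
        - ((1 - σ) * a (i - 1) + (1 - (1 - σ)) * b (i - 1 + 1)) * d i
      + ((σ * c i + (1 - σ) * d (i + 1)) * a i
        - (σ * c (i - 1) + (1 - σ) * d (i - 1 + 1)) * b i))
      = ∑ i, (a i * c i - b i * d i) := by
  have shift : ∀ f : Fin n → ℝ, ∑ i, f (i - 1) = ∑ i, f i := fun f =>
    Equiv.sum_comp (Equiv.subRight (1 : Fin n)) f
  -- A cyclic shift moves left-edge terms to the neighbouring right edge, so each interface collects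
  -- both traces. There the identity is p̂(u⁻ - u⁺) + û(p⁻ - p⁺) = p⁻u⁻ - p⁺u⁺: the mixed products
  -- cancel because the weights are complementary.
  have h1 := shift fun i => ((1 - σ) * a i + (1 - (1 - σ)) * b (i + 1)) * d (i + 1)
      + (σ * c i + (1 - σ) * d (i + 1)) * b (i + 1)
  have h2 := shift fun i => b (i + 1) * d (i + 1)
  simp only [sub_add_cancel] at h1 h2 ⊢
  have h3 : ∑ i, (a i * c i - b i * d i) = ∑ i, (a i * c i - b (i + 1) * d (i + 1)) := by
    rw [Finset.sum_sub_distrib, Finset.sum_sub_distrib, h2]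
  rw [h3]
  calc _ = ∑ i, (((1 - σ) * a i + (1 - (1 - σ)) * b (i + 1)) * c i
        + (σ * c i + (1 - σ) * d (i + 1)) * a i)
        - ∑ i, (((1 - σ) * a (i - 1) + (1 - (1 - σ)) * b i) * d i
          + (σ * c (i - 1) + (1 - σ) * d i) * b i) := by
        rw [← Finset.sum_sub_distrib]
        exact Finset.sum_congr rfl fun i _ => by ring
    _ = _ := by
        rw [h1, ← Finset.sum_sub_distrib]
        exact Finset.sum_congr rfl fun i _ => by ring

@[fun_prop]
lemma continuous_avgX [NeZero Nx] (σ : ℝ) (v : BrokenPoly Nx Ny k) (i : Fin Nx) (j : Fin Ny) :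
    Continuous (avgX M σ v i j) := by
  unfold avgX
  have := fun q => continuous_ev q
  fun_prop

@[fun_prop]
lemma continuous_avgY [NeZero Ny] (σ : ℝ) (v : BrokenPoly Nx Ny k) (i : Fin Nx) (j : Fin Ny) :
    Continuous (avgY M σ v i j) := by
  unfold avgY
  have := fun q => continuous_ev q
  fun_prop

/-- The volume and edge terms of the scheme cancel when the two equations are tested with the
solution itself. -/
theorem sum_volume_sub_edgeTerm [NeZero Nx] [NeZero Ny] (σ₁ σ₂ : ℝ) (u p q : BrokenPoly Nx Ny k) :
    ∑ i, ∑ j, ((∫ x in M.cell i j,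
        (ev (p i j) x * ev (dx (u i j)) x + ev (q i j) x * ev (dy (u i j)) x))
      - edgeTerm M (1 - σ₁) (1 - σ₂) p q i j (u i j) (u i j)
      + ((∫ x in M.cell i j, ev (u i j) x * (ev (dx (p i j)) x + ev (dy (q i j)) x))
      - edgeTerm M σ₁ σ₂ u u i j (p i j) (q i j))) = 0 := by
  have hev := fun q => continuous_ev q
  have hx : ∀ j, ∑ i, ∫ y in (M.yB j)..(M.yT j),
      ((avgX M (1 - σ₁) p i j y * ev (u i j) (M.xR i, y)
        - avgX M (1 - σ₁) p (i - 1) j y * ev (u i j) (M.xL i, y))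
      + (avgX M σ₁ u i j y * ev (p i j) (M.xR i, y)
        - avgX M σ₁ u (i - 1) j y * ev (p i j) (M.xL i, y)))
      = ∑ i, ∫ z in M.cell i j, ev (dx ((p i j : MvPolynomial (Fin 2) ℝ) * u i j)) z := by
    intro j
    simp only [setIntegral_cell_dx, ev_mul]
    rw [← intervalIntegral.integral_finsetSum, ← intervalIntegral.integral_finsetSum]
    · congr 1
      ext y
      -- The cancellation holds at each height y separately; the unsimplified `1 - (1 - σ)` in the
      -- lemma matches the unfolding of `avgX M (1 - σ₁)`.
      exact sum_alternating_flux σ₁ (fun i => ev (p i j) (M.xR i, y))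
        (fun i => ev (p i j) (M.xL i, y)) (fun i => ev (u i j) (M.xR i, y))
        (fun i => ev (u i j) (M.xL i, y))
    · exact fun i _ => Continuous.intervalIntegrable (by fun_prop) _ _
    · exact fun i _ => Continuous.intervalIntegrable (by fun_prop) _ _
  have hy : ∀ i, ∑ j, ∫ x in (M.xL i)..(M.xR i),
      ((avgY M (1 - σ₂) q i j x * ev (u i j) (x, M.yT j)
        - avgY M (1 - σ₂) q i (j - 1) x * ev (u i j) (x, M.yB j))
      + (avgY M σ₂ u i j x * ev (q i j) (x, M.yT j)
        - avgY M σ₂ u i (j - 1) x * ev (q i j) (x, M.yB j)))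
      = ∑ j, ∫ z in M.cell i j, ev (dy ((q i j : MvPolynomial (Fin 2) ℝ) * u i j)) z := by
    intro i
    simp only [setIntegral_cell_dy, ev_mul]
    rw [← intervalIntegral.integral_finsetSum, ← intervalIntegral.integral_finsetSum]
    · congr 1
      ext x
      exact sum_alternating_flux σ₂ (fun j => ev (q i j) (x, M.yT j))
        (fun j => ev (q i j) (x, M.yB j)) (fun j => ev (u i j) (x, M.yT j))
        (fun j => ev (u i j) (x, M.yB j))
    · exact fun i _ => Continuous.intervalIntegrable (by fun_prop) _ _
    · exact fun i _ => Continuous.intervalIntegrable (by fun_prop) _ _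
  have hterm : ∀ i j, (∫ x in M.cell i j,
        (ev (p i j) x * ev (dx (u i j)) x + ev (q i j) x * ev (dy (u i j)) x))
      - edgeTerm M (1 - σ₁) (1 - σ₂) p q i j (u i j) (u i j)
      + ((∫ x in M.cell i j, ev (u i j) x * (ev (dx (p i j)) x + ev (dy (q i j)) x))
      - edgeTerm M σ₁ σ₂ u u i j (p i j) (q i j))
      = ((∫ z in M.cell i j, ev (dx ((p i j : MvPolynomial (Fin 2) ℝ) * u i j)) z)
        - ∫ y in (M.yB j)..(M.yT j),
          ((avgX M (1 - σ₁) p i j y * ev (u i j) (M.xR i, y)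
          - avgX M (1 - σ₁) p (i - 1) j y * ev (u i j) (M.xL i, y))
          + (avgX M σ₁ u i j y * ev (p i j) (M.xR i, y)
          - avgX M σ₁ u (i - 1) j y * ev (p i j) (M.xL i, y))))
        + ((∫ z in M.cell i j, ev (dy ((q i j : MvPolynomial (Fin 2) ℝ) * u i j)) z)
        - ∫ x in (M.xL i)..(M.xR i),
          ((avgY M (1 - σ₂) q i j x * ev (u i j) (x, M.yT j)
          - avgY M (1 - σ₂) q i (j - 1) x * ev (u i j) (x, M.yB j))
          + (avgY M σ₂ u i j x * ev (q i j) (x, M.yT j)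
          - avgY M σ₂ u i (j - 1) x * ev (q i j) (x, M.yB j)))) := by
    intro i j
    have e1 : (∫ x in M.cell i j,
        (ev (p i j) x * ev (dx (u i j)) x + ev (q i j) x * ev (dy (u i j)) x))
      + (∫ x in M.cell i j, ev (u i j) x * (ev (dx (p i j)) x + ev (dy (q i j)) x))
      = (∫ z in M.cell i j, ev (dx ((p i j : MvPolynomial (Fin 2) ℝ) * u i j)) z)
        + ∫ z in M.cell i j, ev (dy ((q i j : MvPolynomial (Fin 2) ℝ) * u i j)) z := by
      rw [← integral_add (integrableOn_cell M i j (by fun_prop))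
        (integrableOn_cell M i j (by fun_prop)), ← integral_add
        (integrableOn_cell M i j (by fun_prop)) (integrableOn_cell M i j (by fun_prop))]
      congr 1
      ext z
      rw [ev_dx_mul, ev_dy_mul]
      ring
    rw [intervalIntegral.integral_add (Continuous.intervalIntegrable (by fun_prop) _ _)
      (Continuous.intervalIntegrable (by fun_prop) _ _),
      intervalIntegral.integral_add (Continuous.intervalIntegrable (by fun_prop) _ _)
      (Continuous.intervalIntegrable (by fun_prop) _ _)]
    unfold edgeTerm
    linarith
  simp only [hterm, Finset.sum_add_distrib, Finset.sum_sub_distrib]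
  have hx' := Finset.sum_congr rfl fun j (_ : j ∈ Finset.univ) => hx j
  replace hx' := (Finset.sum_comm.trans hx').trans Finset.sum_comm
  have hy' := Finset.sum_congr rfl fun i (_ : i ∈ Finset.univ) => hy i
  rw [hx', hy']
  ring

/-- The energy inequality of the semi-discrete scheme. -/
theorem IsSemidiscreteSolution.energy_nonpos [NeZero Nx] [NeZero Ny]
    {M : RectMesh Nx Ny} {α T σ₁ σ₂ : ℝ}
    {κ u₀ : ℝ × ℝ → ℝ}
    {r : ENNReal} {u p q : ℝ → BrokenPoly Nx Ny k}
    (h : IsSemidiscreteSolution M α T σ₁ σ₂ κ u₀ r u p q) :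
    ∀ᵐ t ∂(volume.restrict (Ioc 0 T)), ∑ i, ∑ j,
      ∫ x in M.cell i j, caputoSubst α (κ x) (fun τ => ev (u τ i j) x) t * ev (u t i j) x ≤ 0 := by
  filter_upwards [h.evolution, h.gradient] with t h1 h2
  have h0 := sum_volume_sub_edgeTerm M σ₁ σ₂ (u t) (p t) (q t)
  have hterm : ∀ i j, ((∫ x in M.cell i j,
        (ev (p t i j) x * ev (dx (u t i j)) x + ev (q t i j) x * ev (dy (u t i j)) x))
      - edgeTerm M (1 - σ₁) (1 - σ₂) (p t) (q t) i j (u t i j) (u t i j)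
      + ((∫ x in M.cell i j, ev (u t i j) x * (ev (dx (p t i j)) x + ev (dy (q t i j)) x))
      - edgeTerm M σ₁ σ₂ (u t) (u t) i j (p t i j) (q t i j)))
      = -(∫ x in M.cell i j, caputoSubst α (κ x) (fun τ => ev (u τ i j) x) t * ev (u t i j) x)
        - ∫ x in M.cell i j, (ev (p t i j) x * ev (p t i j) x + ev (q t i j) x * ev (q t i j) x) := by
    intro i j
    -- The test functions are the solution at time t itself: v = u and w = (p, q).
    linarith [h1 i j (u t i j), h2 i j (p t i j) (q t i j)]
  simp only [hterm, Finset.sum_sub_distrib, Finset.sum_neg_distrib] at h0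
  have hpos : 0 ≤ ∑ i, ∑ j, ∫ x in M.cell i j,
      (ev (p t i j) x * ev (p t i j) x + ev (q t i j) x * ev (q t i j) x) :=
    Finset.sum_nonneg fun i _ => Finset.sum_nonneg fun j _ => integral_nonneg fun x =>
      add_nonneg (mul_self_nonneg _) (mul_self_nonneg _)
  linarith

end Green

/-! ### Comparison of the constants. -/

section Constants

/-- Convexity, with Γ(1) = Γ(2) = 1. -/
lemma Gamma_le_one_of_mem_Icc {s : ℝ} (hs : s ∈ Icc (1 : ℝ) 2) : Real.Gamma s ≤ 1 := by
  have h := Real.convexOn_Gamma.2 (show (1 : ℝ) ∈ Ioi 0 by simp) (show (2 : ℝ) ∈ Ioi 0 by simp)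
    (show 0 ≤ 2 - s by linarith [hs.2]) (show 0 ≤ s - 1 by linarith [hs.1]) (by ring)
  simp only [smul_eq_mul, Real.Gamma_one, Real.Gamma_two] at h
  rw [show (2 - s) * 1 + (s - 1) * 2 = s by ring] at h
  linarith

/-- If the base is at most 1, so is the power, and cos(πα) ≤ 1 - 2α² with the half-angle formula
suffices. Otherwise the power is at most its base, cos(πα/2) = sin(π(1-α)/2) ≤ π(1-α)/2, and the
claim reduces to π³α(1-α)/4 ≤ (1+α)². -/
lemma cos_sq_mul_rpow_le {α : ℝ} (hα : 0 < α) (hα1 : α < 1) :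
    Real.cos (Real.pi * α / 2) ^ 2 * (α * Real.pi / (α + 1)) ^ α ≤ 1 - α ^ 2 := by
  have hpi := Real.pi_pos
  rcases le_total (α * Real.pi / (α + 1)) 1 with hle | hge
  · have hX : (α * Real.pi / (α + 1)) ^ α ≤ 1 := Real.rpow_le_one (by positivity) hle hα.le
    have hc : Real.cos (Real.pi * α / 2) ^ 2 ≤ 1 - α ^ 2 := by
      have h1 := Real.cos_le_one_sub_mul_cos_sq (x := Real.pi * α)
        (by rw [abs_of_pos (by positivity)]; nlinarith)
      have h2 := Real.cos_sq (Real.pi * α / 2)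
      rw [show 2 * (Real.pi * α / 2) = Real.pi * α by ring] at h2
      have h3 : 1 - 2 / Real.pi ^ 2 * (Real.pi * α) ^ 2 = 1 - 2 * α ^ 2 := by
        field_simp
      rw [h3] at h1
      linarith
    nlinarith [sq_nonneg (Real.cos (Real.pi * α / 2))]
  · have hX : (α * Real.pi / (α + 1)) ^ α ≤ α * Real.pi / (α + 1) := by
      simpa using Real.rpow_le_rpow_of_exponent_le hge hα1.le
    have hc : Real.cos (Real.pi * α / 2) ^ 2 ≤ (Real.pi * (1 - α) / 2) ^ 2 := by
      rw [show Real.pi * α / 2 = Real.pi / 2 - Real.pi * (1 - α) / 2 by ring,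
        Real.cos_pi_div_two_sub]
      have h0 : 0 ≤ Real.pi * (1 - α) / 2 := by
        have : 0 ≤ 1 - α := by linarith
        positivity
      exact pow_le_pow_left₀ (Real.sin_nonneg_of_nonneg_of_le_pi h0 (by nlinarith))
        (Real.sin_le h0) 2
    calc _ ≤ (Real.pi * (1 - α) / 2) ^ 2 * (α * Real.pi / (α + 1)) := by gcongr
      _ ≤ 1 - α ^ 2 := by
        have h315 := Real.pi_lt_d2
        have h3 : Real.pi ^ 3 ≤ 31.26 :=
          (pow_le_pow_left₀ hpi.le h315.le 3).trans (by norm_num)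
        rw [← mul_div_assoc, div_le_iff₀ (by linarith)]
        have e : (Real.pi * (1 - α) / 2) ^ 2 * (α * Real.pi)
            = (1 - α) * (Real.pi ^ 3 * ((1 - α) * α) / 4) := by ring
        have e' : (1 - α ^ 2) * (α + 1) = (1 - α) * (1 + α) ^ 2 := by ring
        rw [e, e']
        refine mul_le_mul_of_nonneg_left ?_ (by linarith)
        have h4 : 0 ≤ (1 - α) * α := mul_nonneg (by linarith) hα.le
        have h5 := mul_le_mul_of_nonneg_right h3 h4
        -- The quadratic (1+α)² - 7.815 α(1-α) is positive with its minimum near 0.33.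
        nlinarith [sq_nonneg (α - 0.33)]

/-- The Gamma factor and the minimum are at most 1, and `Cmax ^ 2` is at most the maximum; the rest
is `cos_sq_mul_rpow_le` divided by α + 1. -/
lemma le_stabilityConst {α T Cmax : ℝ} (hα : 0 < α) (hα1 : α < 1) (hT : 0 < T) (hC : 1 ≤ Cmax) :
    Cmax ^ 2 * (T / (1 - α)) ≤ stabilityConst α T Cmax := by
  have hpi := Real.pi_pos
  have hcos : 0 < Real.cos (Real.pi * α / 2) :=
    Real.cos_pos_of_mem_Ioo ⟨by nlinarith, by nlinarith⟩
  have hΓ : 0 < Real.Gamma (2 - α) := Real.Gamma_pos_of_pos (by linarith)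
  have hΓ1 := Gamma_le_one_of_mem_Icc (s := 2 - α) ⟨by linarith, by linarith⟩
  have hmin : 0 < min (Cmax ^ (-(4 + 4 * α))) 1 :=
    lt_min (Real.rpow_pos_of_pos (by linarith) _) one_pos
  have hmin1 : min (Cmax ^ (-(4 + 4 * α))) 1 ≤ 1 := min_le_right _ _
  have hX : 0 < (α * Real.pi / (α + 1)) ^ α := Real.rpow_pos_of_pos (by positivity) _
  have hkey := cos_sq_mul_rpow_le hα hα1
  have hmax : Cmax ^ 2 ≤ max (Cmax ^ 6) 1 :=
    (pow_le_pow_right₀ hC (by norm_num)).trans (le_max_left _ _)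
  have hden : Real.cos (Real.pi * α / 2) ^ 2 * (constAlpha α Cmax * Real.Gamma (2 - α))
      ≤ 1 - α := by
    unfold constAlpha
    have h1 : 1 / (α + 1) * (α * Real.pi / (α + 1)) ^ α * min (Cmax ^ (-(4 + 4 * α))) 1
        * Real.Gamma (2 - α) ≤ 1 / (α + 1) * (α * Real.pi / (α + 1)) ^ α := by
      rw [mul_assoc]
      exact mul_le_of_le_one_right (by positivity) (mul_le_one₀ hmin1 hΓ.le hΓ1)
    calc _ ≤ Real.cos (Real.pi * α / 2) ^ 2
          * (1 / (α + 1) * (α * Real.pi / (α + 1)) ^ α) := by gcongr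
      _ = Real.cos (Real.pi * α / 2) ^ 2 * (α * Real.pi / (α + 1)) ^ α / (α + 1) := by ring
      _ ≤ (1 - α ^ 2) / (α + 1) := by gcongr
      _ = 1 - α := by field_simp; ring
  have hCα : 0 < constAlpha α Cmax := by unfold constAlpha; positivity
  have hst : stabilityConst α T Cmax = max (Cmax ^ 6) 1 *
      (T / (Real.cos (Real.pi * α / 2) ^ 2 * (constAlpha α Cmax * Real.Gamma (2 - α)))) := by
    unfold stabilityConst
    field_simp
  rw [hst]
  gcongr

end Constants

/-! ### Monomials as space modes. -/

section Modes

/-- The exponents of the monomials in `Q^k`. -/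
noncomputable def modes (k : ℕ) : Finset (Fin 2 →₀ ℕ) :=
  Finset.Iic (Finsupp.equivFunOnFinite.symm fun _ => k)

/-- The monomial functions on the plane. -/
noncomputable def monomialFun (m : Fin 2 →₀ ℕ) (x : ℝ × ℝ) : ℝ := x.1 ^ m 0 * x.2 ^ m 1

lemma continuous_monomialFun (m : Fin 2 →₀ ℕ) : Continuous (monomialFun m) := by
  unfold monomialFun
  fun_prop

/-- The index set is the same for all polynomials of the space, hence for all times, so the
coefficients can serve as the time-dependent factors of a separated function. -/
lemma ev_eq_sum_modes {k : ℕ} (q : QPoly k) (x : ℝ × ℝ) :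
    ev q x = ∑ m ∈ modes k, MvPolynomial.coeff m (q : MvPolynomial (Fin 2) ℝ) * monomialFun m x := by
  unfold ev
  rw [MvPolynomial.eval_eq']
  simp only [Fin.prod_univ_two, Matrix.cons_val_zero, Matrix.cons_val_one]
  refine Finset.sum_subset (fun m hm => ?_) fun m _ hm => ?_
  · have h := (MvPolynomial.mem_restrictDegree _ _ _).1 q.2 m hm
    simp only [modes, Finset.mem_Iic]
    intro i
    simpa using h i
  · rw [MvPolynomial.notMem_support_iff.1 hm, zero_mul]

end Modes

/-! ### Compactness and finiteness of the mesh domain. -/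

section Geometry

variable {Nx Ny : ℕ} (M : RectMesh Nx Ny)

/-- The closed rectangle. -/
def RectMesh.closedDomain : Set (ℝ × ℝ) :=
  Icc (M.xs 0) (M.xs (Fin.last Nx)) ×ˢ Icc (M.ys 0) (M.ys (Fin.last Ny))

lemma RectMesh.isCompact_closedDomain : IsCompact M.closedDomain :=
  isCompact_Icc.prod isCompact_Icc

lemma RectMesh.domain_subset_closedDomain : M.domain ⊆ M.closedDomain :=
  prod_mono Ioo_subset_Icc_self Ioo_subset_Icc_self

lemma RectMesh.cell_subset_domain (i : Fin Nx) (j : Fin Ny) : M.cell i j ⊆ M.domain :=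
  prod_mono
    (Ioo_subset_Ioo (M.xs_strictMono.monotone (Fin.zero_le _))
      (M.xs_strictMono.monotone (Fin.le_last _)))
    (Ioo_subset_Ioo (M.ys_strictMono.monotone (Fin.zero_le _))
      (M.ys_strictMono.monotone (Fin.le_last _)))

lemma RectMesh.measurableSet_cell (i : Fin Nx) (j : Fin Ny) : MeasurableSet (M.cell i j) :=
  measurableSet_Ioo.prod measurableSet_Ioo

lemma RectMesh.nonempty_domain [NeZero Nx] [NeZero Ny] : M.domain.Nonempty := by
  obtain ⟨x, hx⟩ := nonempty_Ioo.2 (M.xL_lt_xR 0)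
  obtain ⟨y, hy⟩ := nonempty_Ioo.2 (M.yB_lt_yT 0)
  exact ⟨(x, y), M.cell_subset_domain 0 0 ⟨hx, hy⟩⟩

lemma RectMesh.isFiniteMeasure_restrict_cell (i : Fin Nx) (j : Fin Ny) :
    IsFiniteMeasure (volume.restrict (M.cell i j)) := by
  refine ⟨?_⟩
  rw [Measure.restrict_apply_univ]
  exact (measure_mono ((M.cell_subset_domain i j).trans M.domain_subset_closedDomain)).trans_lt
    M.isCompact_closedDomain.measure_lt_top

lemma RectMesh.exists_abs_monomialFun_le (k : ℕ) :
    ∃ B : ℝ, 1 ≤ B ∧ ∀ x ∈ M.domain, ∀ m ∈ modes k, |monomialFun m x| ≤ B := by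
  have hc : ContinuousOn (fun x => ∑ m ∈ modes k, |monomialFun m x|) M.closedDomain :=
    (continuous_finsetSum _ fun m _ => (continuous_monomialFun m).abs).continuousOn
  obtain ⟨B, hB⟩ := M.isCompact_closedDomain.exists_bound_of_continuousOn hc
  -- The bound is raised to 1 so that `abs_le_of_mul_sum_le` can drop it as a factor.
  refine ⟨max 1 B, le_max_left _ _, fun x hx m hm => ?_⟩
  have h1 := Finset.single_le_sum (f := fun m => |monomialFun m x|)
    (fun m _ => abs_nonneg _) hm
  exact (h1.trans ((le_abs_self _).trans (hB x (M.domain_subset_closedDomain hx)))).trans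
    (le_max_right _ _)

end Geometry

/-! ### Energy inequality on the whole mesh and the stability estimate. -/

section Stability

variable {Nx Ny k : ℕ} (M : RectMesh Nx Ny)

lemma l2norm_sq (v : BrokenPoly Nx Ny k) :
    l2norm M v ^ 2 = ∑ i, ∑ j, ∫ x in M.cell i j, ev (v i j) x ^ 2 :=
  Real.sq_sqrt (Finset.sum_nonneg fun _ _ => Finset.sum_nonneg fun _ _ =>
    integral_nonneg fun _ => sq_nonneg _)

lemma memLp_monomialFun (i : Fin Nx) (j : Fin Ny) (m : Fin 2 →₀ ℕ) :
    MemLp (monomialFun m) 2 (volume.restrict (M.cell i j)) := by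
  rw [memLp_two_iff_integrable_sq (continuous_monomialFun m).aestronglyMeasurable]
  exact integrableOn_cell M i j ((continuous_monomialFun m).pow 2)

lemma continuousOn_setIntegral_ev_sq {T : ℝ} (hT : 0 ≤ T) {u : ℝ → BrokenPoly Nx Ny k}
    (hu : ∀ i j m, AbsolutelyContinuousOnInterval
      (fun t => MvPolynomial.coeff m (u t i j : MvPolynomial (Fin 2) ℝ)) 0 T)
    (i : Fin Nx) (j : Fin Ny) :
    ContinuousOn (fun t => ∫ x in M.cell i j, ev (u t i j) x ^ 2) (Icc 0 T) := by
  simp only [ev_eq_sum_modes]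
  refine continuousOn_integral_sq
    (c := fun m t => MvPolynomial.coeff m (u t i j : MvPolynomial (Fin 2) ℝ))
    (fun m _ => ?_) fun m _ => memLp_monomialFun M i j m
  simpa [uIcc_of_le hT] using (hu i j m).continuousOn

/-- The energy inequality for the regularized kernels, for functions with values in the broken
polynomial space whose Caputo substantial derivative does nonpositive work. -/
theorem exists_forall_shiftKer_le [NeZero Nx] [NeZero Ny] {α T K ℓ : ℝ}
    (hα : 0 < α) (hα1 : α < 1) (hT : 0 < T) (hK : 0 ≤ K)
    {κ : ℝ × ℝ → ℝ} (hκ : AEMeasurable κ (volume.restrict M.domain))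
    (hκK : ∀ x ∈ M.domain, |κ x| ≤ K) (hℓ : ∀ x ∈ M.domain, -ℓ ≤ κ x)
    {u : ℝ → BrokenPoly Nx Ny k}
    (hu : ∀ i j m, AbsolutelyContinuousOnInterval
      (fun t => MvPolynomial.coeff m (u t i j : MvPolynomial (Fin 2) ℝ)) 0 T)
    (hen : ∀ᵐ t ∂(volume.restrict (Ioc 0 T)), ∑ i, ∑ j,
      ∫ x in M.cell i j, caputoSubst α (κ x) (fun τ => ev (u τ i j) x) t * ev (u t i j) x ≤ 0) :
    ∃ g : ℝ → ℝ, IntegrableOn g (Ioc 0 T) ∧ (∀ t, 0 ≤ g t) ∧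
      ∀ δ > 0, ∀ᵐ t ∂(volume.restrict (Ioc 0 T)),
        shiftKer α δ 0 * l2norm M (u t) ^ 2
          - shiftKer α δ t * Real.exp (2 * ℓ * t) * l2norm M (u 0) ^ 2
          - (∫ τ in (0 : ℝ)..t,
              shiftKerSlope α δ (t - τ) * Real.exp (2 * ℓ * (t - τ)) * l2norm M (u τ) ^ 2)
        ≤ ∫ τ in (0 : ℝ)..t, ((t - τ) ^ (-α) - shiftKer α δ (t - τ)) * g τ := by
  set c : Fin Nx → Fin Ny → (Fin 2 →₀ ℕ) → ℝ → ℝ :=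
    fun i j m t => MvPolynomial.coeff m (u t i j : MvPolynomial (Fin 2) ℝ) with hc
  have hcc : ∀ i j m, ContinuousOn (c i j m) (Icc 0 T) := fun i j m => by
    simpa [uIcc_of_le hT.le] using (hu i j m).continuousOn
  obtain ⟨B, hB, hBm⟩ := M.exists_abs_monomialFun_le k
  have hB0 : 0 ≤ B := by linarith
  obtain ⟨D, hD⟩ := isCompact_Icc.exists_bound_of_continuousOn
    (continuousOn_finsetSum Finset.univ fun i _ => continuousOn_finsetSum Finset.univ fun j _ =>
      continuousOn_finsetSum (modes k) fun m _ => (hcc i j m).abs)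
  -- One integrable majorant for all cells and modes; it depends neither on t nor on δ, as the limit
  -- δ → 0 requires.
  set g : ℝ → ℝ := fun τ => B * ∑ i, ∑ j, ∑ m ∈ modes k,
    (|deriv (c i j m) τ| + K * |c i j m τ|) with hg
  have hg0 : ∀ t, 0 ≤ g t := fun t => by
    rw [hg]
    positivity
  have hgi : IntegrableOn g (Ioc 0 T) := by
    refine Integrable.const_mul ?_ B
    refine integrable_finsetSum _ fun i _ => integrable_finsetSum _ fun j _ =>
      integrable_finsetSum _ fun m _ => ?_
    refine Integrable.add ?_ ?_
    · have := (hu i j m).intervalIntegrable_deriv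
      rw [intervalIntegrable_iff_integrableOn_Ioc_of_le hT.le] at this
      exact this.abs
    · exact ((continuousOn_const.mul (hcc i j m).abs).integrableOn_compact
        isCompact_Icc).mono_set Ioc_subset_Icc_self
  have hD0 : 0 ≤ D := (norm_nonneg _).trans (hD 0 ⟨le_rfl, hT.le⟩)
  set C : ℝ := ∑ i, ∑ j, (volume.restrict (M.cell i j)).real univ * (D * B * Real.exp (K * T))
    with hC
  have hC0 : 0 ≤ C := by
    rw [hC]
    positivity
  -- C sums the error constants of the cells, and the factor 2 clears the halves in the cellwise
  -- inequalities.
  refine ⟨fun τ => 2 * C * g τ, hgi.const_mul _, fun t => by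
    have := hg0 t
    positivity, fun δ hδ => ?_⟩
  filter_upwards [hen, ae_intervalIntegrable_comp_sub_mul (integrableOn_rpow_neg hα1 hT.le) hgi,
    ae_restrict_mem measurableSet_Ioc] with t hent hgt ht
  set R := ∫ τ in (0 : ℝ)..t, ((t - τ) ^ (-α) - shiftKer α δ (t - τ)) * g τ with hR
  have hR0 : 0 ≤ R := by
    rw [hR, intervalIntegral.integral_of_le ht.1.le, integral_Ioc_eq_integral_Ioo]
    refine setIntegral_nonneg measurableSet_Ioo fun τ hτ => mul_nonneg ?_ (hg0 τ)
    linarith [shiftKer_le_rpow hα hδ (sub_pos.2 hτ.2)]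
  have hsub : uIcc 0 t ⊆ uIcc 0 T := by
    rw [uIcc_of_le ht.1.le, uIcc_of_le hT.le]
    exact Icc_subset_Icc_right ht.2
  have hgt' : IntervalIntegrable g volume 0 t := by
    rw [intervalIntegrable_iff_integrableOn_Ioc_of_le ht.1.le]
    exact hgi.mono_set (Ioc_subset_Ioc_right ht.2)
  have hcell : ∀ i j,
      (shiftKer α δ 0 * (∫ x in M.cell i j, ev (u t i j) x ^ 2)
        - shiftKer α δ t * Real.exp (2 * ℓ * t) * (∫ x in M.cell i j, ev (u 0 i j) x ^ 2)
        - ∫ τ in (0 : ℝ)..t, shiftKerSlope α δ (t - τ) * Real.exp (2 * ℓ * (t - τ))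
          * ∫ x in M.cell i j, ev (u τ i j) x ^ 2) / 2
        - (volume.restrict (M.cell i j)).real univ * (D * B * Real.exp (K * T)) * R
      ≤ Real.Gamma (1 - α) * ∫ x in M.cell i j,
          caputoSubst α (κ x) (fun τ => ev (u τ i j) x) t * ev (u t i j) x := by
    intro i j
    have := M.isFiniteMeasure_restrict_cell i j
    have hmem := ae_restrict_mem (μ := volume) (M.measurableSet_cell i j)
    have h := integral_caputoSubst_energy (μ := volume.restrict (M.cell i j)) (S := modes k)
      (e := monomialFun) (c := c i j) (κ := κ) (K := K) (B := B) (D := D) (ℓ := ℓ) (g := g)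
      hα hα1 hδ ht.1 hK hB (fun m _ => (hu i j m).mono hsub)
      (fun m _ => (continuous_monomialFun m).aestronglyMeasurable)
      (by filter_upwards [hmem] with x hx using hBm x (M.cell_subset_domain i j hx))
      (hκ.mono_measure (Measure.restrict_mono_set _ (M.cell_subset_domain i j)))
      (by filter_upwards [hmem] with x hx using hκK x (M.cell_subset_domain i j hx))
      (by filter_upwards [hmem] with x hx using hℓ x (M.cell_subset_domain i j hx))
      ?_ ?_ hgt hgt'
    · simp only [ev_eq_sum_modes]
      refine le_trans (sub_le_sub_left ?_ _) h
      rw [← mul_assoc]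
      have : Real.exp (K * t) ≤ Real.exp (K * T) :=
        Real.exp_le_exp.2 (mul_le_mul_of_nonneg_left ht.2 hK)
      gcongr
    · refine le_trans ?_ ((le_abs_self _).trans (hD t ⟨ht.1.le, ht.2⟩))
      have h1 := Finset.single_le_sum (f := fun j => ∑ m ∈ modes k, |c i j m t|)
        (fun j _ => by positivity) (Finset.mem_univ j)
      have h2 := Finset.single_le_sum (f := fun i => ∑ j, ∑ m ∈ modes k, |c i j m t|)
        (fun j _ => by positivity) (Finset.mem_univ i)
      exact h1.trans h2
    · intro τ _
      refine mul_le_mul_of_nonneg_left ?_ hB0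
      have h1 := Finset.single_le_sum
        (f := fun j => ∑ m ∈ modes k, (|deriv (c i j m) τ| + K * |c i j m τ|))
        (fun j _ => by positivity) (Finset.mem_univ j)
      have h2 := Finset.single_le_sum
        (f := fun i => ∑ j, ∑ m ∈ modes k, (|deriv (c i j m) τ| + K * |c i j m τ|))
        (fun j _ => by positivity) (Finset.mem_univ i)
      exact h1.trans h2
  have hsum := Finset.sum_le_sum fun i (_ : i ∈ Finset.univ) =>
    Finset.sum_le_sum fun j (_ : j ∈ Finset.univ) => hcell i j
  have hint : ∫ τ in (0 : ℝ)..t, shiftKerSlope α δ (t - τ) * Real.exp (2 * ℓ * (t - τ))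
        * l2norm M (u τ) ^ 2
      = ∑ i, ∑ j, ∫ τ in (0 : ℝ)..t, shiftKerSlope α δ (t - τ) * Real.exp (2 * ℓ * (t - τ))
        * ∫ x in M.cell i j, ev (u τ i j) x ^ 2 := by
    have hii : ∀ i j, IntervalIntegrable (fun τ => shiftKerSlope α δ (t - τ)
        * Real.exp (2 * ℓ * (t - τ)) * ∫ x in M.cell i j, ev (u τ i j) x ^ 2) volume 0 t := by
      intro i j
      apply ContinuousOn.intervalIntegrable
      rw [uIcc_of_le ht.1.le]
      exact ((continuousOn_comp_sub (continuousOn_shiftKerSlope hδ)).mul (by fun_prop)).mul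
        ((continuousOn_setIntegral_ev_sq M hT.le hu i j).mono (Icc_subset_Icc_right ht.2))
    rw [Finset.sum_congr rfl fun i _ =>
      (intervalIntegral.integral_finsetSum fun j _ => hii i j).symm,
      ← intervalIntegral.integral_finsetSum fun i _ => ?_]
    · simp only [l2norm_sq, Finset.mul_sum]
    · convert! IntervalIntegrable.sum Finset.univ fun j _ => hii i j using 1
      ext τ
      simp only [Finset.sum_apply]
  have hRc : ∫ τ in (0 : ℝ)..t, ((t - τ) ^ (-α) - shiftKer α δ (t - τ)) * (2 * C * g τ)
      = 2 * C * R := by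
    rw [hR, ← intervalIntegral.integral_const_mul]
    congr 1
    ext τ
    ring
  rw [hRc, hint, l2norm_sq, l2norm_sq]
  simp only [Finset.sum_sub_distrib, ← Finset.sum_div, ← Finset.mul_sum, ← Finset.sum_mul]
    at hsum hC
  have hΓ : 0 < Real.Gamma (1 - α) := Real.Gamma_pos_of_pos (by linarith)
  have h0 := mul_nonpos_of_nonneg_of_nonpos hΓ.le hent
  rw [← hC] at hsum
  linarith

/-- The stability estimate with the constant `e^{2ℓT} T / (1 - α)`, where `-ℓ` bounds the potential
from below. -/
theorem integral_l2norm_sq_le [NeZero Nx] [NeZero Ny] {α T K ℓ : ℝ}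
    (hα : 0 < α) (hα1 : α < 1) (hT : 0 < T) (hK : 0 ≤ K) (hℓ0 : 0 ≤ ℓ)
    {κ : ℝ × ℝ → ℝ} (hκ : AEMeasurable κ (volume.restrict M.domain))
    (hκK : ∀ x ∈ M.domain, |κ x| ≤ K) (hℓ : ∀ x ∈ M.domain, -ℓ ≤ κ x)
    {u : ℝ → BrokenPoly Nx Ny k}
    (hu : ∀ i j m, AbsolutelyContinuousOnInterval
      (fun t => MvPolynomial.coeff m (u t i j : MvPolynomial (Fin 2) ℝ)) 0 T)
    (hen : ∀ᵐ t ∂(volume.restrict (Ioc 0 T)), ∑ i, ∑ j,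
      ∫ x in M.cell i j, caputoSubst α (κ x) (fun τ => ev (u τ i j) x) t * ev (u t i j) x ≤ 0) :
    ∫ t in (0 : ℝ)..T, l2norm M (u t) ^ 2
      ≤ Real.exp (2 * ℓ * T) * (T / (1 - α)) * l2norm M (u 0) ^ 2 := by
  obtain ⟨g, hgi, hg0, hg⟩ := exists_forall_shiftKer_le M hα hα1 hT hK hκ hκK hℓ hu hen
  have hE : ContinuousOn (fun t => l2norm M (u t) ^ 2) (Icc 0 T) := by
    simp only [l2norm_sq]
    exact continuousOn_finsetSum _ fun i _ => continuousOn_finsetSum _ fun j _ =>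
      continuousOn_setIntegral_ev_sq M hT.le hu i j
  -- This weight splits e^{2ℓ(t-τ)} between the times t and τ, which turns the history term into a
  -- plain convolution with the slope.
  have hF : ContinuousOn (fun t => Real.exp (-(2 * ℓ * t)) * l2norm M (u t) ^ 2) (Icc 0 T) :=
    ContinuousOn.mul (by fun_prop) hE
  have hmain := integral_le_of_forall_shiftKer hα hα1 hT hF (fun t _ => by positivity) hgi
    (fun t _ => hg0 t) ?_
  · simp only [mul_zero, neg_zero, Real.exp_zero, one_mul] at hmain
    have h1 : ∫ t in (0 : ℝ)..T, l2norm M (u t) ^ 2 ≤ ∫ t in (0 : ℝ)..T,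
        Real.exp (2 * ℓ * T) * (Real.exp (-(2 * ℓ * t)) * l2norm M (u t) ^ 2) := by
      refine intervalIntegral.integral_mono_on hT.le ?_ ?_ fun t ht => ?_
      · exact ContinuousOn.intervalIntegrable (by rwa [uIcc_of_le hT.le])
      · exact ContinuousOn.intervalIntegrable
          (by rw [uIcc_of_le hT.le]; exact continuousOn_const.mul hF)
      · rw [← mul_assoc, ← Real.exp_add]
        refine le_mul_of_one_le_left (sq_nonneg _) (Real.one_le_exp ?_)
        nlinarith [ht.2]
    rw [intervalIntegral.integral_const_mul] at h1
    rw [mul_assoc]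
    exact h1.trans (mul_le_mul_of_nonneg_left hmain (Real.exp_pos _).le)
  · intro δ hδ
    filter_upwards [hg δ hδ, ae_restrict_mem measurableSet_Ioc] with t ht htm
    set R := ∫ τ in (0 : ℝ)..t, ((t - τ) ^ (-α) - shiftKer α δ (t - τ)) * g τ with hR
    have hR0 : 0 ≤ R := by
      rw [hR, intervalIntegral.integral_of_le htm.1.le, integral_Ioc_eq_integral_Ioo]
      refine setIntegral_nonneg measurableSet_Ioo fun τ hτ => mul_nonneg ?_ (hg0 τ)
      linarith [shiftKer_le_rpow hα hδ (sub_pos.2 hτ.2)]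
    have h1 := mul_le_mul_of_nonneg_left ht (Real.exp_pos (-(2 * ℓ * t))).le
    have h2 : Real.exp (-(2 * ℓ * t)) * R ≤ R := by
      refine mul_le_of_le_one_left hR0 (Real.exp_le_one_iff.2 ?_)
      have := htm.1
      have : 0 ≤ 2 * ℓ * t := by positivity
      linarith
    have h3 : ∫ τ in (0 : ℝ)..t, shiftKerSlope α δ (t - τ)
          * (Real.exp (-(2 * ℓ * τ)) * l2norm M (u τ) ^ 2)
        = Real.exp (-(2 * ℓ * t)) * ∫ τ in (0 : ℝ)..t,
          shiftKerSlope α δ (t - τ) * Real.exp (2 * ℓ * (t - τ)) * l2norm M (u τ) ^ 2 := by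
      rw [← intervalIntegral.integral_const_mul]
      congr 1
      ext τ
      rw [show -(2 * ℓ * τ) = -(2 * ℓ * t) + 2 * ℓ * (t - τ) by ring, Real.exp_add]
      ring
    have h4 : Real.exp (-(2 * ℓ * t)) * Real.exp (2 * ℓ * t) = 1 := by
      rw [← Real.exp_add]
      simp
    rw [h3]
    simp only [mul_zero, neg_zero, Real.exp_zero, one_mul]
    refine le_trans (le_of_eq ?_) (h1.trans h2)
    linear_combination (-(shiftKer α δ t) * l2norm M (u 0) ^ 2) * (-h4)

end Stability

end LDG

theorem theorem3p1 {Nx Ny : ℕ} [NeZero Nx] [NeZero Ny] (M : LDG.RectMesh Nx Ny) (k : ℕ)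
    (α T σ₁ σ₂ Cκ Cmax : ℝ) (hα0 : 0 < α) (hα1 : α < 1) (hT : 0 < T)
    (hσ₁ : σ₁ ≠ 1 / 2) (hσ₂ : σ₂ ≠ 1 / 2)
    (κ : ℝ × ℝ → ℝ) (hκ : AEMeasurable κ (volume.restrict M.domain))
    (hCκ : ∀ x ∈ M.domain, |κ x| ≤ Cκ)
    (hCmax : ∀ t ∈ Icc 0 T, ∀ x ∈ M.domain, Real.exp (-κ x * t) ≤ Cmax)
    (u₀ : ℝ × ℝ → ℝ) (hu₀ : MemLp u₀ 2 (volume.restrict M.domain))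
    (r : ENNReal) (hr : 1 ≤ r) (u p q : ℝ → LDG.BrokenPoly Nx Ny k)
    (hu : LDG.IsSemidiscreteSolution M α T σ₁ σ₂ κ u₀ r u p q) :
    ∫ t in (0 : ℝ)..T, LDG.l2norm M (u t) ^ 2
      ≤ LDG.stabilityConst α T Cmax * LDG.l2norm M (u 0) ^ 2 := by
  obtain ⟨x₀, hx₀⟩ := M.nonempty_domain
  -- The bound at t = 0, at some point of the nonempty domain.
  have hC1 : 1 ≤ Cmax := by simpa using hCmax 0 ⟨le_rfl, hT.le⟩ x₀ hx₀
  -- The bound at t = T yields the lower bound of κ with ℓ = log(Cmax)/T, so that e^{2ℓT} is exactly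
  -- `Cmax ^ 2`.
  have hℓ : ∀ x ∈ M.domain, -(Real.log Cmax / T) ≤ κ x := by
    intro x hx
    have h1 := (Real.le_log_iff_exp_le (by linarith)).2 (hCmax T ⟨hT.le, le_rfl⟩ x hx)
    have h2 : -κ x ≤ Real.log Cmax / T := (le_div_iff₀ hT).2 h1
    linarith
  have hmain := LDG.integral_l2norm_sq_le M hα0 hα1 hT ((abs_nonneg _).trans (hCκ x₀ hx₀))
    (div_nonneg (Real.log_nonneg hC1) hT.le) hκ hCκ hℓ
    (fun i j m => (hu.regularity_u i j m).1) hu.energy_nonpos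
  have hexp : Real.exp (2 * (Real.log Cmax / T) * T) = Cmax ^ 2 := by
    rw [show 2 * (Real.log Cmax / T) * T = Real.log Cmax + Real.log Cmax by field_simp; ring,
      Real.exp_add, Real.exp_log (by linarith), sq]
  rw [hexp] at hmain
  exact hmain.trans (mul_le_mul_of_nonneg_right (LDG.le_stabilityConst hα0 hα1 hT hC1)
    (sq_nonneg _))
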